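/- Let $\theta^*\in\mathbb R^M$ and let $N$ sensors observe $z_n(i)=\bar H_n\theta^*+\gamma(i)\zeta_n(i)$, $i=0,1,2,\dots$, with $\bar H_n\in\mathbb R^{M_n\times M}$ and $\gamma(i)=(i+1)^{\gamma_0}$ for a fixed $0\le\gamma_0<1/2$. Assume: (i) the stacked noise vectors $\zeta(i)=[\zeta_1(i)^T,\dots,\zeta_N(i)^T]^T$ are i.i.d. in $i$ (possibly correlated across sensors) with zero mean, finite second moment and $\mathbb E\|\zeta(i)\|^{2+\varepsilon}<\infty$ for a given $\varepsilon>0$; (ii) $G=\sum_{n=1}^N\bar H_n^T\bar H_n$ has full rank; (iii) the sensors communicate at time $i$ over a random undirected simple graph on $\{1,\dots,N\}$ with Laplacian $L(i)$ and neighborhoods $\Omega_n(i)$; the $L(i)$ are i.i.d. in $i$, and the mean $\bar L=\mathbb E[L(i)]$ satisfies $\lambda_2(\bar L)>0$, where $\lambda_2$ is the second smallest eigenvalue counted with multiplicity (no condition if $N=1$); (iv) the sequences $\{L(i)\}$ and $\{\zeta(i)\}$ are independent of each other. Given design parameters $(\tau_1,a,\tau_2,b,K)$ put $\alpha(i)=a/(i+1)^{\tau_1}$,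 $\beta(i)=b/(i+1)^{\tau_2}$. The corresponding $\mathcal{GLU}$ estimator starts from arbitrary deterministic $x_n(0)\in\mathbb R^M$ and evolves as $$x_n(i+1)=x_n(i)-\beta(i)\sum_{l\in\Omega_n(i)}\bigl(x_n(i)-x_l(i)\bigr)+\alpha(i)K\bar H_n^T\bigl(z_n(i)-\bar H_nx_n(i)\bigr).$$ The parameters satisfy (A.6) if $a,b>0$, $0<\tau_2\le\tau_1\le1$, $\tau_1>\max\bigl(\tfrac12+\gamma_0,\ \tau_2+\gamma_0+\tfrac1{2+\varepsilon}\bigr)$, and $K$ is symmetric positive definite and commutes with $G$. (1) For all parameters satisfying (A.6), $x_n(i)\to\theta^*$ almost surely for every sensor $n$. (2) Let $(\tau_1,a,K)$ be the parameters of a good centralized linear estimator, that is, $a>0$, $\tfrac12+\gamma_0<\tau_1\le1$, $K$ is symmetric positive definite and commutes with $G$, and $$u(i+1)=u(i)+\frac{\alpha(i)}N K\sum_{n=1}^N\bigl(\bar H_n^Tz_n(i)-\bar H_n^T\bar H_nu(i)\bigr),\qquad \alpha(i)=\frac a{(i+1)^{\tau_1}},$$ from an arbitrary initial value $u(0)$.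 Then there are $\tau_2,b$ such that $(\tau_1,a,\tau_2,b,K)$ satisfies (A.6). Moreover, for all such $\tau_2,b$, for the $\mathcal{GLU}$ estimator with these parameters, and for every $0\le\tau_0<\tau_1-\tau_2-\gamma_0-\frac1{2+\varepsilon}$ with, in case $\tau_1=1$, $a>N\tau_0/\lambda_{\min}(KG)$, one has $$(i+1)^{\tau_0}\bigl(x_n(i)-u(i)\bigr)\to0\quad\text{almost surely, for every sensor } n.$$ -/

import Mathlib

open MeasureTheory ProbabilityTheory Filter Topology Matrix

noncomputable section

namespace GLU

/-- The weight sequence `c / (i + 1) ^ τ`. -/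
def weight (c τ : ℝ) (i : ℕ) : ℝ := c / ((i : ℝ) + 1) ^ τ

open Classical in
/-- The Laplacian `L = D - A` of an undirected simple graph on the sensors. -/
def laplacian {N : ℕ} (Γ : SimpleGraph (Fin N)) : Matrix (Fin N) (Fin N) ℝ :=
  Γ.lapMatrix ℝ

/-- The process of Laplacians of a sequence of random graphs, each read as the family of its
entries. -/
def randomLaplacian {Ω : Type*} {N : ℕ} (Γ : ℕ → Ω → SimpleGraph (Fin N)) (i : ℕ) (ω : Ω) :
    Fin N → Fin N → ℝ :=
  fun n l => laplacian (Γ i ω) n l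

/-- The mean Laplacian (entrywise expectation) of a random graph. -/
def meanLaplacian {Ω : Type*} [MeasurableSpace Ω] (P : Measure Ω) {N : ℕ}
    (Γ : Ω → SimpleGraph (Fin N)) : Matrix (Fin N) (Fin N) ℝ :=
  Matrix.of fun n l => ∫ ω, laplacian (Γ ω) n l ∂P

theorem meanLaplacian_isHermitian {Ω : Type*} [MeasurableSpace Ω] (P : Measure Ω) {N : ℕ}
    (Γ : Ω → SimpleGraph (Fin N)) : (meanLaplacian P Γ).IsHermitian := by
  classical
  ext n l
  have h : ∀ ω, laplacian (Γ ω) l n = laplacian (Γ ω) n l := fun ω =>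
    (SimpleGraph.isSymm_lapMatrix (R := ℝ) (Γ ω)).apply n l
  simp [meanLaplacian, h]

/-- `λ₂`: the second smallest eigenvalue, counted with multiplicity, of a symmetric matrix of
size at least two (`eigenvalues₀` lists the eigenvalues in decreasing order). -/
def lambda2 {N : ℕ} (A : Matrix (Fin N) (Fin N) ℝ) (hA : A.IsHermitian) (hN : 2 ≤ N) : ℝ :=
  hA.eigenvalues₀ ⟨N - 2, by rw [Fintype.card_fin]; omega⟩

/-- The smallest (real) eigenvalue of a square matrix. -/
def lambdaMin {M : ℕ} (A : Matrix (Fin M) (Fin M) ℝ) : ℝ := sInf (spectrum ℝ A)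

/-- The Grammian `G = ∑ₙ Hₙᵀ Hₙ`. -/
def gram {N M : ℕ} {m : Fin N → ℕ} (H : (n : Fin N) → Matrix (Fin (m n)) (Fin M) ℝ) :
    Matrix (Fin M) (Fin M) ℝ :=
  ∑ n, (H n)ᵀ * H n

/-- The observation `zₙ(i) = Hₙ θ + (i + 1) ^ γ₀ ζₙ(i)` of sensor `n` at time `i`; the noise
vectors of all the sensors are stacked into one Euclidean vector `ζ`. -/
def observation {N M : ℕ} {m : Fin N → ℕ} (H : (n : Fin N) → Matrix (Fin (m n)) (Fin M) ℝ)
    (θ : Fin M → ℝ) (γ₀ : ℝ) (i : ℕ) (ζ : EuclideanSpace ℝ (Σ n : Fin N, Fin (m n)))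
    (n : Fin N) : Fin (m n) → ℝ :=
  H n *ᵥ θ + (((i : ℝ) + 1) ^ γ₀) • fun k => ζ ⟨n, k⟩

open Classical in
/-- The distributed estimates `xₙ(i)` along one sample path of graphs `Γ(i)` and observations
`zₙ(i)`, from the initial estimates `x₀`. -/
def glu {N M : ℕ} {m : Fin N → ℕ} (H : (n : Fin N) → Matrix (Fin (m n)) (Fin M) ℝ)
    (K : Matrix (Fin M) (Fin M) ℝ) (α β : ℕ → ℝ) (Γ : ℕ → SimpleGraph (Fin N))
    (z : ℕ → (n : Fin N) → Fin (m n) → ℝ) (x₀ : Fin N → Fin M → ℝ) :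
    ℕ → Fin N → Fin M → ℝ
  | 0 => x₀
  | i + 1 => fun n =>
      let x := glu H K α β Γ z x₀ i
      x n - β i • ∑ l with (Γ i).Adj n l, (x n - x l)
        + α i • (K *ᵥ ((H n)ᵀ *ᵥ (z i n - H n *ᵥ x n)))

/-- The centralized linear estimate `u(i)` along one sample path of observations `zₙ(i)`, from
the initial value `u₀`. -/
def centralized {N M : ℕ} {m : Fin N → ℕ} (H : (n : Fin N) → Matrix (Fin (m n)) (Fin M) ℝ)
    (K : Matrix (Fin M) (Fin M) ℝ) (α : ℕ → ℝ)
    (z : ℕ → (n : Fin N) → Fin (m n) → ℝ) (u₀ : Fin M → ℝ) : ℕ → Fin M → ℝ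
  | 0 => u₀
  | i + 1 =>
      let u := centralized H K α z u₀ i
      u + (α i / (N : ℝ)) •
        (K *ᵥ ∑ n, ((H n)ᵀ *ᵥ z i n - ((H n)ᵀ * H n) *ᵥ u))

/-- The stacked noise is i.i.d. in time (arbitrarily correlated across sensors), has zero mean,
a finite second moment and a finite moment of order `2 + ε`. -/
structure NoiseAssumption {Ω : Type*} [MeasurableSpace Ω] (P : Measure Ω) {N : ℕ}
    {m : Fin N → ℕ} (ε : ℝ) (ζ : ℕ → Ω → EuclideanSpace ℝ (Σ n : Fin N, Fin (m n))) :
    Prop where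
  measurable : ∀ i, Measurable (ζ i)
  indep : iIndepFun ζ P
  identDistrib : ∀ i, IdentDistrib (ζ i) (ζ 0) P P
  mean_zero : ∀ i, ∫ ω, ζ i ω ∂P = 0
  second_moment : ∀ i, Integrable (fun ω => ‖ζ i ω‖ ^ 2) P
  moment : ∀ i, Integrable (fun ω => ‖ζ i ω‖ ^ (2 + ε)) P

/-- The Laplacians of the random communication graphs are i.i.d. in time, and their mean
satisfies `λ₂ > 0` (a condition which is void for a network of a single sensor). -/
structure LinkAssumption {Ω : Type*} [MeasurableSpace Ω] (P : Measure Ω) {N : ℕ}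
    (Γ : ℕ → Ω → SimpleGraph (Fin N)) : Prop where
  measurable : ∀ i, Measurable (randomLaplacian Γ i)
  indep : iIndepFun (randomLaplacian Γ) P
  identDistrib : ∀ i, IdentDistrib (randomLaplacian Γ i) (randomLaplacian Γ 0) P P
  connected_mean : ∀ hN : 2 ≤ N,
    0 < lambda2 (meanLaplacian P (Γ 0)) (meanLaplacian_isHermitian P (Γ 0)) hN

/-- The conditions on the design parameters `(τ₁, a, τ₂, b, K)` of the distributed estimator. -/
structure DesignAssumption {M : ℕ} (G : Matrix (Fin M) (Fin M) ℝ) (γ₀ ε τ₁ a τ₂ b : ℝ)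
    (K : Matrix (Fin M) (Fin M) ℝ) : Prop where
  a_pos : 0 < a
  b_pos : 0 < b
  τ₂_pos : 0 < τ₂
  τ₂_le : τ₂ ≤ τ₁
  τ₁_le : τ₁ ≤ 1
  τ₁_gt : max (1 / 2 + γ₀) (τ₂ + γ₀ + 1 / (2 + ε)) < τ₁
  K_posDef : K.PosDef
  K_comm : Commute K G

/-- The conditions on the design parameters `(τc, ac, Kc)` of a good centralized linear
estimator. -/
structure GoodCentralized {M : ℕ} (G : Matrix (Fin M) (Fin M) ℝ) (γ₀ τc ac : ℝ)
    (Kc : Matrix (Fin M) (Fin M) ℝ) : Prop where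
  a_pos : 0 < ac
  K_posDef : Kc.PosDef
  K_comm : Commute Kc G
  τ_gt : 1 / 2 + γ₀ < τc
  τ_le : τc ≤ 1

end GLU

end

namespace GLU

/-! The distributed estimates are compared path by path with the centralized estimate `u`, which is
consistent by itself. The error of `u` obeys a linear recursion contracting at rate `λ_min(KG) / N`;
its noise weights are square summable because `τ₁ - γ₀ > 1/2`, so the noise series converges almost
surely (`ae_exists_tendsto_sum_of_iIndepFun`) and the error vanishes
(`tendsto_zero_of_convergent_input`).

The difference `x n - u` splits into the disagreement `x n - avg` and `avg - u`. Laplacian columns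
sum to zero, so consensus does not move `avg`, and `avg` receives the same averaged noise as `u`.
The noise therefore cancels in `avg - u`, which contracts and is driven by the disagreement alone.

The disagreement is given by variation of constants through random products of consensus steps on
zero-sum vectors. Independence in time and coercivity of the mean Laplacian bound their mean square
by `N² ∏ (1 - c β i)`. Summing over all pairs of times and interpolating with the trivial bound `N`
gives an almost sure bound with a smaller `c` and a factor `(t + 1) ^ δ` (`ae_transition_le`). The
`2 + ε` moment bounds the noise by `(t + 1) ^ (1 / (2 + ε) + δ)`. What remains is a deterministic
two-time-scale system of scalar inequalities (`tendsto_rpow_mul_of_coupled_recursion`). Consistency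
is the case `τ₀ = 0`. -/

/-! ### Scalar recursions with polynomial gains. -/

theorem weight_eq (c τ : ℝ) (i : ℕ) : weight c τ i = c * ((i : ℝ) + 1) ^ (-τ) := by
  rw [weight, Real.rpow_neg (by positivity), div_eq_mul_inv]

theorem tendsto_natCast_add_one_atTop : Tendsto (fun t : ℕ => (t : ℝ) + 1) atTop atTop :=
  tendsto_atTop_add_const_right _ _ tendsto_natCast_atTop_atTop

theorem tendsto_rpow_neg_natCast {p : ℝ} (hp : 0 < p) :
    Tendsto (fun t : ℕ => ((t : ℝ) + 1) ^ (-p)) atTop (𝓝 0) :=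
  (tendsto_rpow_neg_atTop hp).comp tendsto_natCast_add_one_atTop

theorem eventually_mul_rpow_neg_le {p e : ℝ} (c : ℝ) (hp : 0 < p) (he : 0 < e) :
    ∀ᶠ t : ℕ in atTop, c * ((t : ℝ) + 1) ^ (-p) ≤ e := by
  have h := (tendsto_rpow_neg_natCast hp).const_mul c
  rw [mul_zero] at h
  exact h.eventually (Iic_mem_nhds he)

/-- A Bernoulli inequality for `(1 + 1/T) ^ (-κ)`, from `1 + x ≤ exp x` and `log (1 + x) ≤ x`. For
`κ ≤ 0` the power does not decrease and no correction is needed. -/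
theorem one_sub_div_mul_rpow_le (κ : ℝ) {T : ℝ} (hT : 0 < T) :
    (1 - max κ 0 / T) * T ^ (-κ) ≤ (T + 1) ^ (-κ) := by
  rcases le_or_gt κ 0 with h | h
  · rw [max_eq_right h, zero_div, sub_zero, one_mul]
    exact Real.rpow_le_rpow hT.le (by linarith) (by linarith)
  · rw [max_eq_left h.le]
    have hT1 : 0 < 1 + 1 / T := by positivity
    have e1 : T + 1 = T * (1 + 1 / T) := by field_simp
    rw [e1, Real.mul_rpow hT.le hT1.le, mul_comm]
    gcongr
    rw [Real.rpow_def_of_pos hT1]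
    have h1 := Real.add_one_le_exp (Real.log (1 + 1 / T) * -κ)
    have h2 := Real.log_le_sub_one_of_pos hT1
    have h3 : κ * Real.log (1 + 1 / T) ≤ κ * (1 / T) :=
      mul_le_mul_of_nonneg_left (by linarith) h.le
    have h4 : κ / T = κ * (1 / T) := by ring
    linarith

/-- A scalar recursion with contraction `c (t + 1) ^ (-τ)` and input of order
`(t + 1) ^ (-τ - κ)` decays (or grows) at most like `(t + 1) ^ (-κ)`. -/
theorem eventually_le_rpow_of_recursion {y : ℕ → ℝ} {τ c C κ : ℝ} (hτ : 0 < τ) (hτ1 : τ ≤ 1)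
    (hc : 0 < c) (hC : 0 ≤ C) (hκ : τ = 1 → κ < c)
    (hy : ∀ᶠ t : ℕ in atTop, y (t + 1) ≤ (1 - c * ((t : ℝ) + 1) ^ (-τ)) * y t
      + C * ((t : ℝ) + 1) ^ (-τ - κ)) :
    ∃ B : ℝ, 0 < B ∧ ∀ᶠ t : ℕ in atTop, y t ≤ B * ((t : ℝ) + 1) ^ (-κ) := by
  -- The part `c'` of the contraction pays for the decrease of `(t + 1) ^ (-κ)` in one step, a
  -- relative loss `κ / (t + 1)`. For `τ < 1` any `c' > 0` works eventually; for `τ = 1` this is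
  -- where `κ < c` enters.
  obtain ⟨c', hc', hc'0, hev⟩ : ∃ c' < c, 0 ≤ c' ∧
      ∀ᶠ t : ℕ in atTop, max κ 0 / ((t : ℝ) + 1) ≤ c' * ((t : ℝ) + 1) ^ (-τ) := by
    rcases hτ1.lt_or_eq with h | h
    · refine ⟨c / 2, by linarith, by linarith, ?_⟩
      filter_upwards [eventually_mul_rpow_neg_le (max κ 0) (sub_pos.2 h) (half_pos hc)] with t ht
      have hT : (0 : ℝ) < (t : ℝ) + 1 := by positivity
      have : max κ 0 / ((t : ℝ) + 1)
          = (max κ 0 * ((t : ℝ) + 1) ^ (-(1 - τ))) * ((t : ℝ) + 1) ^ (-τ) := by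
        rw [mul_assoc, ← Real.rpow_add hT, show -(1 - τ) + -τ = -1 by ring, Real.rpow_neg_one,
          div_eq_mul_inv]
      rw [this]
      gcongr
    · refine ⟨max κ 0, max_lt (hκ h) hc, le_max_right _ _, Eventually.of_forall fun t => ?_⟩
      rw [h, Real.rpow_neg_one, div_eq_mul_inv]
  obtain ⟨t₀, ht₀⟩ := eventually_atTop.1
    (hy.and (hev.and (eventually_mul_rpow_neg_le c hτ one_pos)))
  -- The first entry lets the remaining contraction `c - c'` absorb the input, the `+ 1` keeping `B`
  -- positive when `C = 0`; the second starts the induction at `t₀`.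
  set B := max (C / (c - c') + 1) (y t₀ * ((t₀ : ℝ) + 1) ^ κ) with hB
  have hcc : 0 < c - c' := sub_pos.2 hc'
  have hB0 : 0 < B := lt_max_of_lt_left (by positivity)
  refine ⟨B, hB0, eventually_atTop.2 ⟨t₀, fun t ht => ?_⟩⟩
  induction t, ht using Nat.le_induction with
  | base =>
    have hT : (0 : ℝ) < (t₀ : ℝ) + 1 := by positivity
    calc y t₀ = (y t₀ * ((t₀ : ℝ) + 1) ^ κ) * ((t₀ : ℝ) + 1) ^ (-κ) := by
          rw [mul_assoc, ← Real.rpow_add hT, add_neg_cancel, Real.rpow_zero, mul_one]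
      _ ≤ _ := by gcongr; exact le_max_right _ _
  | succ t ht ih =>
    obtain ⟨h1, h2, h3⟩ := ht₀ t ht
    have hT : (0 : ℝ) < (t : ℝ) + 1 := by positivity
    have hpk : 0 < ((t : ℝ) + 1) ^ (-κ) := by positivity
    have hpt : 0 < ((t : ℝ) + 1) ^ (-τ) := by positivity
    have hCB : C ≤ (c - c') * B := by
      have : C / (c - c') ≤ B := le_trans (by linarith) (le_max_left _ _)
      rwa [div_le_iff₀ hcc, mul_comm] at this
    calc y (t + 1) ≤ (1 - c * ((t : ℝ) + 1) ^ (-τ)) * y t + C * ((t : ℝ) + 1) ^ (-τ - κ) := h1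
      _ ≤ (1 - c * ((t : ℝ) + 1) ^ (-τ)) * (B * ((t : ℝ) + 1) ^ (-κ))
          + ((c - c') * B) * ((t : ℝ) + 1) ^ (-τ - κ) := by
          have : 0 ≤ 1 - c * ((t : ℝ) + 1) ^ (-τ) := by linarith
          gcongr
      _ = B * ((1 - c' * ((t : ℝ) + 1) ^ (-τ)) * ((t : ℝ) + 1) ^ (-κ)) := by
          rw [sub_eq_add_neg (-τ), Real.rpow_add hT]; ring
      _ ≤ B * ((1 - max κ 0 / ((t : ℝ) + 1)) * ((t : ℝ) + 1) ^ (-κ)) := by gcongr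
      _ ≤ B * ((t : ℝ) + 1 + 1) ^ (-κ) := by gcongr; exact one_sub_div_mul_rpow_le κ hT
      _ = B * (((t + 1 : ℕ) : ℝ) + 1) ^ (-κ) := by push_cast; rfl

/-- A nonnegative sequence driven towards a null sequence by non-summable gains tends to `0`. -/
theorem tendsto_zero_of_recursion {y a e : ℕ → ℝ} (hy0 : ∀ t, 0 ≤ y t)
    (ha0 : ∀ᶠ t in atTop, 0 ≤ a t) (ha1 : ∀ᶠ t in atTop, a t ≤ 1)
    (ha : Tendsto (fun t => ∑ i ∈ Finset.range t, a i) atTop atTop)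
    (he : Tendsto e atTop (𝓝 0))
    (hy : ∀ᶠ t in atTop, y (t + 1) ≤ (1 - a t) * y t + a t * e t) :
    Tendsto y atTop (𝓝 0) := by
  refine tendsto_order.2 ⟨fun r hr => Eventually.of_forall fun t => hr.trans_le (hy0 t),
    fun r hr => ?_⟩
  obtain ⟨t₀, ht₀⟩ := eventually_atTop.1
    (hy.and (ha0.and (ha1.and (he.eventually (Iio_mem_nhds (half_pos hr))))))
  set S : ℕ → ℝ := fun t => ∑ i ∈ Finset.range t, a i with hS
  -- Once `e t < r / 2`, the excess of `y` over `r / 2` is multiplied by at most `1 - a t ≤ exp (-a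
  -- t)`.
  have key : ∀ t ≥ t₀, y t - r / 2 ≤ y t₀ * Real.exp (-(S t - S t₀)) := by
    intro t ht
    induction t, ht using Nat.le_induction with
    | base => simp; linarith
    | succ t ht ih =>
      obtain ⟨h1, h2, h3, h4⟩ := ht₀ t ht
      have h5 : a t * e t ≤ a t * (r / 2) := mul_le_mul_of_nonneg_left (le_of_lt h4) h2
      have hSt : S (t + 1) = S t + a t := Finset.sum_range_succ _ _
      have h6 : 1 - a t ≤ Real.exp (-a t) := Real.one_sub_le_exp_neg _
      calc y (t + 1) - r / 2 ≤ (1 - a t) * (y t - r / 2) := by nlinarith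
        _ ≤ (1 - a t) * (y t₀ * Real.exp (-(S t - S t₀))) :=
          mul_le_mul_of_nonneg_left ih (by linarith)
        _ ≤ Real.exp (-a t) * (y t₀ * Real.exp (-(S t - S t₀))) :=
          mul_le_mul_of_nonneg_right h6 (mul_nonneg (hy0 _) (Real.exp_pos _).le)
        _ = y t₀ * Real.exp (-(S (t + 1) - S t₀)) := by
          rw [hSt, show -(S t + a t - S t₀) = -a t + -(S t - S t₀) by ring, Real.exp_add]; ring
  have hlim : Tendsto (fun t => y t₀ * Real.exp (-(S t - S t₀))) atTop (𝓝 0) := by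
    have h1 : Tendsto (fun t => S t - S t₀) atTop atTop :=
      tendsto_atTop_add_const_right _ _ ha
    simpa using (Real.tendsto_exp_neg_atTop_nhds_zero.comp h1).const_mul (y t₀)
  filter_upwards [hlim.eventually (Iio_mem_nhds (half_pos hr)), eventually_ge_atTop t₀] with t h1 h2
  have h3 := key t h2
  have h4 : y t₀ * Real.exp (-(S t - S t₀)) < r / 2 := h1
  linarith

theorem tendsto_sum_weight_atTop {a τ : ℝ} (ha : 0 < a) (hτ : τ ≤ 1) :
    Tendsto (fun t => ∑ i ∈ Finset.range t, weight a τ i) atTop atTop := by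
  have h := Real.tendsto_sum_range_one_div_nat_succ_atTop.const_mul_atTop ha
  refine tendsto_atTop_mono (fun t => ?_) h
  rw [Finset.mul_sum]
  refine Finset.sum_le_sum fun i _ => ?_
  have hT : (1 : ℝ) ≤ (i : ℝ) + 1 := by linarith [(Nat.cast_nonneg i : (0 : ℝ) ≤ i)]
  rw [weight, mul_one_div]
  gcongr
  exact (Real.rpow_le_rpow_of_exponent_le hT hτ).trans_eq (Real.rpow_one _)

/-- Decay of the coupled system formed by a fast variable `y` (gain `(t + 1) ^ (-τ₂)`), an
observable `X` of it with a polynomial loss, and a slow variable `w` (gain `(t + 1) ^ (-τ₁)`). -/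
theorem tendsto_rpow_mul_of_coupled_recursion {X y w : ℕ → ℝ} {τ₁ τ₂ a b C δ ρ μ τ₀ : ℝ}
    (hX0 : ∀ t, 0 ≤ X t) (hy0 : ∀ᶠ t in atTop, 0 ≤ y t) (hw0 : ∀ t, 0 ≤ w t)
    (hτ₁ : τ₁ ≤ 1) (hτ₂ : 0 < τ₂) (ha : 0 < a) (hb : 0 < b) (hC : 0 < C) (hδ : 0 < δ)
    (hρ : 0 ≤ ρ) (hμ : 0 < μ) (hτ₀ : 0 ≤ τ₀)
    (hrate : τ₀ < τ₁ - τ₂ - ρ - δ) (hrate1 : τ₁ = 1 → τ₀ < a * μ)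
    (hX : ∀ᶠ t : ℕ in atTop, X t ≤ C * ((t : ℝ) + 1) ^ δ * y t)
    (hy : ∀ᶠ t : ℕ in atTop, y (t + 1) ≤ (1 - b * ((t : ℝ) + 1) ^ (-τ₂)) * y t
      + a * ((t : ℝ) + 1) ^ (-τ₁) * (C * (((t : ℝ) + 1) ^ ρ + w t + X t)))
    (hw : ∀ᶠ t : ℕ in atTop, w (t + 1) ≤ (1 - a * ((t : ℝ) + 1) ^ (-τ₁) * μ) * w t
      + a * ((t : ℝ) + 1) ^ (-τ₁) * (C * X t)) :
    Tendsto (fun t : ℕ => ((t : ℝ) + 1) ^ τ₀ * (X t + w t)) atTop (𝓝 0) := by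
  have hgap : 0 < τ₁ - τ₂ - δ := by linarith
  have hτ₁0 : 0 < τ₁ := by linarith
  have hT : ∀ t : ℕ, (0 : ℝ) < (t : ℝ) + 1 := fun t => by positivity
  have hT1 : ∀ t : ℕ, (1 : ℝ) ≤ (t : ℝ) + 1 := fun t => by
    linarith [(Nat.cast_nonneg t : (0 : ℝ) ≤ t)]
  -- gains of the slow scale are negligible against those of the fast scale
  have hsmall : ∀ D e : ℝ, 0 < e → ∀ᶠ t : ℕ in atTop,
      D * (((t : ℝ) + 1) ^ (-τ₁) * ((t : ℝ) + 1) ^ δ) ≤ e * ((t : ℝ) + 1) ^ (-τ₂) := by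
    intro D e he
    filter_upwards [eventually_mul_rpow_neg_le D hgap he] with t ht
    have : ((t : ℝ) + 1) ^ (-τ₁) * ((t : ℝ) + 1) ^ δ
        = ((t : ℝ) + 1) ^ (-(τ₁ - τ₂ - δ)) * ((t : ℝ) + 1) ^ (-τ₂) := by
      rw [← Real.rpow_add (hT t), ← Real.rpow_add (hT t)]; congr 1; ring
    rw [this, ← mul_assoc]
    exact mul_le_mul_of_nonneg_right ht (by positivity)
  -- a priori polynomial growth
  set k : ℝ := μ / (2 * C) with hk
  have hk0 : 0 < k := by positivity
  have hkC : k * C = μ / 2 := by rw [hk]; field_simp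
  obtain ⟨B₁, hB₁, hV⟩ : ∃ B : ℝ, 0 < B ∧ ∀ᶠ t : ℕ in atTop,
      w t + k * y t ≤ B * ((t : ℝ) + 1) ^ (-(-ρ)) := by
    refine eventually_le_rpow_of_recursion (y := fun t => w t + k * y t) (τ := τ₁)
      (c := a * μ / 2) (C := k * C * a) hτ₁0 hτ₁ (by positivity)
      (by positivity) (fun _ => by have := mul_pos ha hμ; linarith) ?_
    filter_upwards [hX, hy, hw, hy0, hsmall (a * C ^ 2 * (1 + k) + k * a * μ / 2) (k * b)
      (by positivity)] with t h1 h2 h3 h4 h5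
    set p := ((t : ℝ) + 1) ^ (-τ₁)
    set q := ((t : ℝ) + 1) ^ (-τ₂)
    set d := ((t : ℝ) + 1) ^ δ
    set r := ((t : ℝ) + 1) ^ ρ
    have hp : 0 < p := Real.rpow_pos_of_pos (hT t) _
    have hd : 1 ≤ d := Real.one_le_rpow (hT1 t) hδ.le
    have hpr : ((t : ℝ) + 1) ^ (-τ₁ - -ρ) = p * r := by
      rw [← Real.rpow_add (hT t)]; congr 1; ring
    rw [hpr]
    have e1 : a * p * (C * X t) ≤ a * p * (C * (C * d * y t)) := by gcongr
    have e2 : k * (a * p * (C * (r + w t + X t)))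
        ≤ k * (a * p * (C * (r + w t + C * d * y t))) := by gcongr
    have e3 : k * a * μ / 2 * p * y t ≤ k * a * μ / 2 * (p * d) * y t := by
      gcongr; exact le_mul_of_one_le_right hp.le hd
    have e4 := mul_le_mul_of_nonneg_right h5 h4
    have e5 := mul_le_mul_of_nonneg_left h2 hk0.le
    have e6 : k * (a * p * (C * w t)) = a * p * (μ / 2) * w t := by rw [← hkC]; ring
    linear_combination h3 + e1 + e5 + e2 + e3 + e4 + e6
  -- decay of the fast variable
  obtain ⟨B₂, hB₂, hY⟩ : ∃ B : ℝ, 0 < B ∧ ∀ᶠ t : ℕ in atTop,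
      y t ≤ B * ((t : ℝ) + 1) ^ (-(τ₁ - τ₂ - ρ)) := by
    refine eventually_le_rpow_of_recursion (τ := τ₂) (c := b / 2) (C := a * C * (1 + B₁)) hτ₂
      (by linarith) (by positivity) (by positivity) (fun h => by linarith) ?_
    filter_upwards [hX, hy, hV, hy0, hsmall (a * C ^ 2) (b / 2) (by positivity)]
      with t h1 h2 h3 h4 h5
    rw [neg_neg] at h3
    have hpr : ((t : ℝ) + 1) ^ (-τ₂ - (τ₁ - τ₂ - ρ))
        = ((t : ℝ) + 1) ^ (-τ₁) * ((t : ℝ) + 1) ^ ρ := by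
      rw [← Real.rpow_add (hT t)]; congr 1; ring
    rw [hpr]
    set p := ((t : ℝ) + 1) ^ (-τ₁)
    set q := ((t : ℝ) + 1) ^ (-τ₂)
    set d := ((t : ℝ) + 1) ^ δ
    set r := ((t : ℝ) + 1) ^ ρ
    have hp : 0 < p := Real.rpow_pos_of_pos (hT t) _
    have e0 : w t ≤ B₁ * r := by nlinarith
    have e1 : a * p * (C * (r + w t + X t)) ≤ a * p * (C * (r + B₁ * r + C * d * y t)) := by
      gcongr
    have e4 := mul_le_mul_of_nonneg_right h5 h4
    linear_combination h2 + e1 + e4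
  have hX' : ∀ᶠ t : ℕ in atTop, X t ≤ C * B₂ * ((t : ℝ) + 1) ^ (-(τ₁ - τ₂ - ρ - δ)) := by
    filter_upwards [hX, hY] with t h1 h2
    refine h1.trans ?_
    have : ((t : ℝ) + 1) ^ (-(τ₁ - τ₂ - ρ - δ))
        = ((t : ℝ) + 1) ^ δ * ((t : ℝ) + 1) ^ (-(τ₁ - τ₂ - ρ)) := by
      rw [← Real.rpow_add (hT t)]; congr 1; ring
    rw [this]
    calc _ ≤ C * ((t : ℝ) + 1) ^ δ * (B₂ * ((t : ℝ) + 1) ^ (-(τ₁ - τ₂ - ρ))) := by gcongr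
      _ = _ := by ring
  -- decay of the slow variable
  obtain ⟨κ, hκ0, hκ1, hκ2⟩ : ∃ κ, τ₀ < κ ∧ κ ≤ τ₁ - τ₂ - ρ - δ ∧ (τ₁ = 1 → κ < a * μ) := by
    by_cases h : τ₁ = 1
    · obtain ⟨κ, h1, h2⟩ := exists_between (lt_min hrate (hrate1 h))
      exact ⟨κ, h1, (h2.le.trans (min_le_left _ _)), fun _ => h2.trans_le (min_le_right _ _)⟩
    · exact ⟨_, hrate, le_rfl, fun h' => (h h').elim⟩
  have hX'' : ∀ᶠ t : ℕ in atTop, X t ≤ C * B₂ * ((t : ℝ) + 1) ^ (-κ) := by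
    filter_upwards [hX'] with t ht
    refine ht.trans ?_
    gcongr
    exact hT1 t
  obtain ⟨B₃, hB₃, hW⟩ : ∃ B : ℝ, 0 < B ∧ ∀ᶠ t : ℕ in atTop,
      w t ≤ B * ((t : ℝ) + 1) ^ (-κ) := by
    refine eventually_le_rpow_of_recursion (τ := τ₁) (c := a * μ) (C := a * C * (C * B₂)) hτ₁0
      hτ₁ (by positivity) (by positivity) hκ2 ?_
    filter_upwards [hX'', hw] with t h1 h2
    rw [sub_eq_add_neg (-τ₁), Real.rpow_add (hT t)]
    have e1 : a * ((t : ℝ) + 1) ^ (-τ₁) * (C * X t)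
      ≤ a * ((t : ℝ) + 1) ^ (-τ₁) * (C * (C * B₂ * ((t : ℝ) + 1) ^ (-κ))) := by gcongr
    linear_combination h2 + e1
  have hlim := (tendsto_rpow_neg_natCast (sub_pos.2 hκ0)).const_mul (C * B₂ + B₃)
  rw [mul_zero] at hlim
  refine squeeze_zero' (Eventually.of_forall fun t =>
    mul_nonneg (by positivity) (add_nonneg (hX0 t) (hw0 t))) ?_ hlim
  filter_upwards [hX'', hW] with t h1 h2
  have : ((t : ℝ) + 1) ^ (-(κ - τ₀)) = ((t : ℝ) + 1) ^ τ₀ * ((t : ℝ) + 1) ^ (-κ) := by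
    rw [← Real.rpow_add (hT t)]; congr 1; ring
  rw [this]
  calc _ ≤ ((t : ℝ) + 1) ^ τ₀ * (C * B₂ * ((t : ℝ) + 1) ^ (-κ) + B₃ * ((t : ℝ) + 1) ^ (-κ)) := by
        gcongr
    _ = _ := by ring

/-! ### Graph Laplacians and the consensus step. -/

section Laplacian

variable {N : ℕ}

theorem laplacian_apply (Γ : SimpleGraph (Fin N)) [DecidableRel Γ.Adj] (n l : Fin N) :
    laplacian Γ n l = (if n = l then (Γ.degree n : ℝ) else 0) - if Γ.Adj n l then 1 else 0 := by
  classical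
  unfold laplacian
  simp only [SimpleGraph.lapMatrix, SimpleGraph.degMatrix, Matrix.sub_apply,
    Matrix.diagonal_apply, SimpleGraph.adjMatrix_apply]
  congr!

theorem laplacian_symm (Γ : SimpleGraph (Fin N)) (n l : Fin N) :
    laplacian Γ n l = laplacian Γ l n := by
  classical
  exact ((SimpleGraph.isSymm_lapMatrix (R := ℝ) Γ).apply n l).symm

open Classical in
theorem sum_laplacian_smul {E : Type*} [AddCommGroup E] [Module ℝ E] (Γ : SimpleGraph (Fin N))
    (x : Fin N → E) (n : Fin N) :
    ∑ l, laplacian Γ n l • x l = ∑ l with Γ.Adj n l, (x n - x l) := by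
  have hdeg : ∑ l with Γ.Adj n l, x n = (Γ.degree n : ℝ) • x n := by
    rw [Finset.sum_const, ← Nat.cast_smul_eq_nsmul ℝ]
    congr 2
    rw [← SimpleGraph.card_neighborFinset_eq_degree, SimpleGraph.neighborFinset_eq_filter]
  simp only [laplacian_apply, sub_smul, ite_smul, zero_smul, one_smul, Finset.sum_sub_distrib,
    Finset.sum_ite_eq, Finset.mem_univ, if_true]
  rw [hdeg, Finset.sum_filter]

theorem sum_laplacian_row (Γ : SimpleGraph (Fin N)) (n : Fin N) : ∑ l, laplacian Γ n l = 0 := by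
  classical
  simpa using sum_laplacian_smul Γ (fun _ => (1 : ℝ)) n

theorem sum_laplacian_col (Γ : SimpleGraph (Fin N)) (l : Fin N) : ∑ n, laplacian Γ n l = 0 := by
  simp_rw [fun n => laplacian_symm Γ n l]
  exact sum_laplacian_row Γ l

theorem abs_laplacian_le (Γ : SimpleGraph (Fin N)) (n l : Fin N) : |laplacian Γ n l| ≤ N := by
  classical
  have h1 : (Γ.degree n : ℝ) ≤ N := by
    have := (Γ.degree_lt_card_verts n).le
    rw [Fintype.card_fin] at this
    exact_mod_cast this
  have h2 : (1 : ℝ) ≤ N := by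
    have : 0 < N := n.pos
    exact_mod_cast this
  have h0 : (0 : ℝ) ≤ (Γ.degree n : ℝ) := by positivity
  rw [laplacian_apply, abs_le]
  by_cases h : n = l
  · rw [if_pos h, h, if_neg (Γ.irrefl)]
    constructor <;> linarith [h ▸ h0, h ▸ h1]
  · split_ifs <;> constructor <;> linarith

/-- One consensus step with a small weight dissipates the Laplacian energy. -/
theorem sum_sq_sub_laplacian_le (Γ : SimpleGraph (Fin N)) {β : ℝ} (hβ : 0 ≤ β)
    (hβN : β * (2 * N) ≤ 1) (v : Fin N → ℝ) :
    ∑ n, (v n - β * ∑ l, laplacian Γ n l * v l) ^ 2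
      ≤ ∑ n, v n ^ 2 - β * ∑ n, ∑ l, laplacian Γ n l * (v n * v l) := by
  classical
  set D : Fin N → ℝ := fun n => ∑ l, laplacian Γ n l * v l with hD
  have hD' : ∀ n, D n = ∑ l, if Γ.Adj n l then v n - v l else 0 := fun n => by
    rw [← Finset.sum_filter]
    have := sum_laplacian_smul Γ v n
    simp only [smul_eq_mul] at this
    rw [hD]
    convert this
  -- Over ordered pairs the quadratic form is `S / 2`, while Cauchy–Schwarz bounds the squared norm
  -- of `D` by `N * S`. So `2 N β ≤ 1` makes the second-order term cost at most one of the two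
  -- first-order terms `β S / 2`.
  set S : ℝ := ∑ n, ∑ l, if Γ.Adj n l then (v n - v l) ^ 2 else 0 with hS
  have hQ : ∑ n, ∑ l, laplacian Γ n l * (v n * v l) = ∑ n, v n * D n := by
    refine Finset.sum_congr rfl fun n _ => ?_
    rw [hD, Finset.mul_sum]
    exact Finset.sum_congr rfl fun l _ => by ring
  have hQS : ∑ n, v n * D n = S / 2 := by
    have h1 : ∑ n, v n * D n = ∑ n, ∑ l, if Γ.Adj n l then v n * (v n - v l) else 0 := by
      refine Finset.sum_congr rfl fun n _ => ?_
      rw [hD', Finset.mul_sum]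
      exact Finset.sum_congr rfl fun l _ => by rw [mul_ite, mul_zero]
    have h2 : ∑ n, v n * D n = ∑ n, ∑ l, if Γ.Adj n l then v l * (v l - v n) else 0 := by
      rw [h1, Finset.sum_comm]
      refine Finset.sum_congr rfl fun n _ => Finset.sum_congr rfl fun l _ => ?_
      simp only [Γ.adj_comm n l]
    have h3 : ∑ n, v n * D n + ∑ n, v n * D n = S := by
      nth_rewrite 1 [h1]
      rw [h2, hS, ← Finset.sum_add_distrib]
      refine Finset.sum_congr rfl fun n _ => ?_
      rw [← Finset.sum_add_distrib]
      refine Finset.sum_congr rfl fun l _ => ?_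
      split_ifs <;> ring
    linarith
  have hDS : ∑ n, D n ^ 2 ≤ N * S := by
    rw [hS, Finset.mul_sum]
    refine Finset.sum_le_sum fun n _ => ?_
    rw [hD']
    refine (sq_sum_le_card_mul_sum_sq).trans_eq ?_
    rw [Finset.card_univ, Fintype.card_fin]
    congr 1
    exact Finset.sum_congr rfl fun l _ => by split_ifs <;> simp
  have hS0 : 0 ≤ S := Finset.sum_nonneg fun n _ => Finset.sum_nonneg fun l _ => by
    split_ifs <;> positivity
  have hexp : ∑ n, (v n - β * D n) ^ 2
      = ∑ n, v n ^ 2 - 2 * β * ∑ n, v n * D n + β ^ 2 * ∑ n, D n ^ 2 := by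
    rw [Finset.mul_sum, Finset.mul_sum, ← Finset.sum_sub_distrib, ← Finset.sum_add_distrib]
    exact Finset.sum_congr rfl fun n _ => by ring
  rw [hexp, hQ, hQS]
  have h1 : β ^ 2 * ∑ n, D n ^ 2 ≤ β ^ 2 * (N * S) := by gcongr
  have h2 : β * (2 * N) * (β * S) ≤ 1 * (β * S) := by gcongr
  linarith

end Laplacian

/-! ### Spectral bounds for symmetric matrices. -/

section Spectral

variable {n : Type*} [Fintype n] [DecidableEq n] {A : Matrix n n ℝ}

theorem inner_eigenvectorBasis_mulVec (hA : A.IsHermitian) (v : n → ℝ) (j : n) :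
    inner ℝ (hA.eigenvectorBasis j) (WithLp.toLp 2 (A *ᵥ v))
      = hA.eigenvalues j * inner ℝ (hA.eigenvectorBasis j) (WithLp.toLp 2 v) := by
  have h := hA.mulVec_eigenvectorBasis j
  have hT : Aᵀ = A := by simpa [Matrix.IsHermitian, conjTranspose_eq_transpose_of_trivial] using hA
  simp only [EuclideanSpace.inner_eq_star_dotProduct, star_trivial]
  rw [dotProduct_comm, dotProduct_mulVec, ← mulVec_transpose, hT, h, smul_dotProduct,
    dotProduct_comm, smul_eq_mul]

theorem dotProduct_eq_sum_eigenvectorBasis (hA : A.IsHermitian) (v w : n → ℝ) :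
    v ⬝ᵥ w = ∑ j, inner ℝ (hA.eigenvectorBasis j) (WithLp.toLp 2 v)
      * inner ℝ (hA.eigenvectorBasis j) (WithLp.toLp 2 w) := by
  have h := hA.eigenvectorBasis.sum_inner_mul_inner (WithLp.toLp 2 v) (WithLp.toLp 2 w)
  rw [EuclideanSpace.inner_eq_star_dotProduct, star_trivial, dotProduct_comm] at h
  rw [← show _ = v ⬝ᵥ w from h]
  exact Finset.sum_congr rfl fun j _ => by rw [real_inner_comm]

theorem lambdaMin_mul_le {M : ℕ} {A : Matrix (Fin M) (Fin M) ℝ} (hA : A.IsHermitian)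
    (v : Fin M → ℝ) : lambdaMin A * (v ⬝ᵥ v) ≤ v ⬝ᵥ (A *ᵥ v) := by
  rw [dotProduct_eq_sum_eigenvectorBasis hA, dotProduct_eq_sum_eigenvectorBasis hA, Finset.mul_sum]
  refine Finset.sum_le_sum fun j _ => ?_
  rw [inner_eigenvectorBasis_mulVec]
  have h : lambdaMin A ≤ hA.eigenvalues j := by
    rw [lambdaMin, hA.spectrum_real_eq_range_eigenvalues]
    exact csInf_le (Set.finite_range _).bddBelow (Set.mem_range_self j)
  nlinarith [mul_self_nonneg (inner ℝ (hA.eigenvectorBasis j) (WithLp.toLp 2 v))]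

theorem lambdaMin_pos {M : ℕ} (hM : 0 < M) {A : Matrix (Fin M) (Fin M) ℝ} (hA : A.IsHermitian)
    (hpos : ∀ (μ : ℝ) (v : Fin M → ℝ), v ≠ 0 → A *ᵥ v = μ • v → 0 < μ) : 0 < lambdaMin A := by
  have : Nonempty (Fin M) := ⟨⟨0, hM⟩⟩
  have h : lambdaMin A ∈ Set.range hA.eigenvalues := by
    rw [lambdaMin, hA.spectrum_real_eq_range_eigenvalues]
    exact (Set.range_nonempty _).csInf_mem (Set.finite_range _)
  obtain ⟨j, hj⟩ := h
  rw [← hj]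
  exact hpos _ _ ((WithLp.ofLp_eq_zero 2).ne.2 <| hA.eigenvectorBasis.orthonormal.ne_zero j)
    (hA.mulVec_eigenvectorBasis j)

/-- A symmetric matrix which annihilates constants is coercive, with constant `λ₂`, on the
vectors of zero sum. -/
theorem lambda2_mul_le {N : ℕ} (hN : 2 ≤ N) {A : Matrix (Fin N) (Fin N) ℝ} (hA : A.IsHermitian)
    (hA1 : A *ᵥ 1 = 0) (hpos : 0 < lambda2 A hA hN) {v : Fin N → ℝ} (hv : ∑ k, v k = 0) :
    lambda2 A hA hN * (v ⬝ᵥ v) ≤ v ⬝ᵥ (A *ᵥ v) := by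
  set e := Fintype.equivOfCardEq (Fintype.card_fin (Fintype.card (Fin N))) with he
  have hcard : Fintype.card (Fin N) = N := Fintype.card_fin N
  -- Index of the last, hence smallest, entry of the decreasing list; `e` is the reindexing built
  -- into `eigenvalues`. All other eigenvalues are at least `λ₂ > 0`, so the kernel vector `1` is a
  -- nonzero multiple of the `j₀`-th eigenvector, and zero-sum vectors have no component along it.
  set j₀ : Fin N := e ⟨N - 1, by omega⟩ with hj₀
  have hle : ∀ j, j ≠ j₀ → lambda2 A hA hN ≤ hA.eigenvalues j := by
    intro j hj
    refine hA.eigenvalues₀_antitone (Fin.le_def.2 ?_)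
    have h1 := (e.symm j).isLt
    have h2 : (e.symm j : ℕ) ≠ N - 1 := fun h =>
      hj (e.symm_apply_eq.1 (Fin.ext h))
    change (e.symm j : ℕ) ≤ N - 2
    omega
  set c : Fin N → ℝ := fun j => inner ℝ (hA.eigenvectorBasis j) (WithLp.toLp 2 (1 : Fin N → ℝ))
  set d : Fin N → ℝ := fun j => inner ℝ (hA.eigenvectorBasis j) (WithLp.toLp 2 v)
  have hc : ∀ j, j ≠ j₀ → c j = 0 := fun j hj => by
    have h := inner_eigenvectorBasis_mulVec hA 1 j
    rw [hA1, WithLp.toLp_zero, inner_zero_right] at h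
    exact (mul_eq_zero.1 h.symm).resolve_left (hpos.trans_le (hle j hj)).ne'
  have hc0 : c j₀ ≠ 0 := fun h0 => by
    have h := dotProduct_eq_sum_eigenvectorBasis hA 1 1
    rw [Finset.sum_eq_zero (fun j _ => ?_)] at h
    · simp [dotProduct] at h
      omega
    · have : c j = 0 := by
        by_cases hj : j = j₀
        · rw [hj, h0]
        · exact hc j hj
      change c j * c j = 0
      rw [this, zero_mul]
  have hd : d j₀ = 0 := by
    have h := dotProduct_eq_sum_eigenvectorBasis hA 1 v
    rw [Finset.sum_eq_single j₀ (fun j _ hj => ?_) (fun h => (h (Finset.mem_univ _)).elim)] at h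
    · rw [one_dotProduct, hv] at h
      exact (mul_eq_zero.1 h.symm).resolve_left hc0
    · change c j * d j = 0
      rw [hc j hj, zero_mul]
  rw [dotProduct_eq_sum_eigenvectorBasis hA, dotProduct_eq_sum_eigenvectorBasis hA, Finset.mul_sum]
  refine Finset.sum_le_sum fun j _ => ?_
  rw [inner_eigenvectorBasis_mulVec]
  change _ * (d j * d j) ≤ d j * (_ * d j)
  by_cases hj : j = j₀
  · rw [hj, hd]; simp
  · nlinarith [mul_self_nonneg (d j), hle j hj]

end Spectral

/-- In the expansion of the square, giving up `lam - μ` of the coercivity pays for the quadratic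
term `s² C²`; then `1 - 2 s μ ≤ (1 - s μ)²`. -/
theorem norm_sub_smul_le {E : Type*} [NormedAddCommGroup E] [InnerProductSpace ℝ E] {T : E → E}
    {lam μ C s : ℝ} {v : E} (hT : lam * ‖v‖ ^ 2 ≤ inner ℝ v (T v)) (hC : ‖T v‖ ≤ C * ‖v‖)
    (hs : 0 ≤ s) (hs1 : s * C ^ 2 ≤ 2 * (lam - μ)) (hs2 : s * μ ≤ 1) :
    ‖v - s • T v‖ ≤ (1 - s * μ) * ‖v‖ := by
  refine abs_le_of_sq_le_sq' ?_ (mul_nonneg (by linarith) (norm_nonneg _)) |>.2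
  have h1 : ‖T v‖ ^ 2 ≤ (C * ‖v‖) ^ 2 := by gcongr
  rw [norm_sub_sq_real, inner_smul_right, norm_smul, mul_pow, Real.norm_eq_abs, sq_abs]
  have h2 := mul_le_mul_of_nonneg_left h1 (sq_nonneg s)
  have h3 := mul_le_mul_of_nonneg_left hT hs
  have h4 := mul_le_mul_of_nonneg_right hs1 (mul_nonneg hs (sq_nonneg ‖v‖))
  have h5 : 0 ≤ (s * μ) ^ 2 * ‖v‖ ^ 2 := by positivity
  nlinarith

/-! ### Positivity of the gain `K G`. -/

section Gain

variable {N M : ℕ} {m : Fin N → ℕ} {H : (n : Fin N) → Matrix (Fin (m n)) (Fin M) ℝ}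
  {K : Matrix (Fin M) (Fin M) ℝ}

theorem gram_posDef (hG : (gram H).rank = M) : (gram H).PosDef := by
  have h1 : (gram H).PosSemidef := by
    rw [gram]
    refine Finset.sum_induction _ _ (fun _ _ => PosSemidef.add) PosSemidef.zero fun n _ => ?_
    simpa [conjTranspose_eq_transpose_of_trivial] using posSemidef_conjTranspose_mul_self (H n)
  rw [h1.posDef_iff_isUnit, ← mulVec_surjective_iff_isUnit]
  have h2 : LinearMap.range (gram H).mulVecLin = ⊤ := by
    refine Submodule.eq_top_of_finrank_eq ?_
    rw [← Matrix.rank, hG, Module.finrank_fin_fun]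
  exact LinearMap.range_eq_top.1 h2

theorem isHermitian_gain_mul_gram (hK : K.PosDef) (hG : (gram H).PosDef)
    (hc : Commute K (gram H)) : (K * gram H).IsHermitian := by
  rw [Matrix.IsHermitian, conjTranspose_mul, hK.isHermitian.eq, hG.isHermitian.eq, hc.eq]

/-- Pairing `K G v = μ v` with `G v` gives a positive number on the left and `μ` times a positive
number on the right. For `M = 0` the spectrum is empty and `sInf ∅ = 0`, hence `hM`. -/
theorem lambdaMin_gain_mul_gram_pos (hM : 0 < M) (hK : K.PosDef) (hG : (gram H).PosDef)
    (hc : Commute K (gram H)) : 0 < lambdaMin (K * gram H) := by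
  refine lambdaMin_pos hM (isHermitian_gain_mul_gram hK hG hc) fun μ v hv hμ => ?_
  have h0 : gram H *ᵥ v ≠ 0 := fun h => by
    have := hG.dotProduct_mulVec_pos hv
    simp [h] at this
  have h1 := hK.dotProduct_mulVec_pos h0
  have h2 := hG.dotProduct_mulVec_pos hv
  rw [mulVec_mulVec, hμ, dotProduct_smul, smul_eq_mul, star_trivial, dotProduct_comm] at h1
  rw [star_trivial] at h2
  exact (pos_iff_pos_of_mul_pos h1).2 h2

end Gain

theorem summable_rpow_neg {p : ℝ} (hp : 1 < p) :
    Summable fun t : ℕ => ((t : ℝ) + 1) ^ (-p) := by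
  have h := (summable_nat_add_iff 1).2 (Real.summable_nat_rpow.2 (neg_lt_neg hp))
  simpa using h

/-! ### Almost sure bounds and convergence of random series. -/

section General

variable {Ω : Type*} [MeasurableSpace Ω] {P : Measure Ω}

/-- A countable family of nonnegative random variables with summable means is almost surely
bounded. -/
theorem ae_exists_bound_of_summable_integral {ι : Type*} [Countable ι] {f : ι → Ω → ℝ}
    (hf0 : ∀ i ω, 0 ≤ f i ω) (hint : ∀ i, Integrable (f i) P)
    (hsum : Summable fun i => ∫ ω, f i ω ∂P) :
    ∀ᵐ ω ∂P, ∃ C : ℝ, 0 ≤ C ∧ ∀ i, f i ω ≤ C := by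
  have hmeas : ∀ i, AEMeasurable (fun ω => ENNReal.ofReal (f i ω)) P := fun i =>
    (hint i).aestronglyMeasurable.aemeasurable.ennreal_ofReal
  have h : ∫⁻ ω, ∑' i, ENNReal.ofReal (f i ω) ∂P ≠ ⊤ := by
    rw [lintegral_tsum hmeas]
    simp_rw [fun i => (ofReal_integral_eq_lintegral_ofReal (hint i)
      (Eventually.of_forall (hf0 i))).symm]
    exact hsum.tsum_ofReal_ne_top
  filter_upwards [ae_lt_top' (AEMeasurable.tsum hmeas) h] with ω hω
  refine ⟨(∑' i, ENNReal.ofReal (f i ω)).toReal, ENNReal.toReal_nonneg, fun i => ?_⟩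
  rw [← ENNReal.ofReal_le_iff_le_toReal hω.ne]
  exact ENNReal.le_tsum i

/-- Almost sure polynomial growth of an identically distributed sequence with a finite moment of
order `p`. -/
theorem ae_norm_le_rpow {E : Type*} [NormedAddCommGroup E] [MeasurableSpace E] [BorelSpace E]
    {ζ : ℕ → Ω → E} {p δ : ℝ} (hp : 0 < p) (hδ : 0 < δ)
    (hid : ∀ i, IdentDistrib (ζ i) (ζ 0) P P)
    (hint : ∀ i, Integrable (fun ω => ‖ζ i ω‖ ^ p) P) :
    ∀ᵐ ω ∂P, ∃ C : ℝ, 0 ≤ C ∧ ∀ i : ℕ, ‖ζ i ω‖ ≤ C * ((i : ℝ) + 1) ^ (1 / p + δ) := by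
  have hmean : ∀ i, ∫ ω, ‖ζ i ω‖ ^ p ∂P = ∫ ω, ‖ζ 0 ω‖ ^ p ∂P := fun i =>
    ((hid i).comp (measurable_norm.pow_const p)).integral_eq
  have hq : 1 < 1 + δ * p := by have := mul_pos hδ hp; linarith
  -- The weight `(i + 1) ^ (-(1 + δ p))` is just summable, and its `p`-th root yields the exponent
  -- `1 / p + δ`.
  have h := ae_exists_bound_of_summable_integral (P := P)
    (f := fun (i : ℕ) ω => ‖ζ i ω‖ ^ p * ((i : ℝ) + 1) ^ (-(1 + δ * p)))
    (fun i ω => by positivity) (fun i => (hint i).mul_const _) (by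
      simp_rw [integral_mul_const, hmean]
      exact (summable_rpow_neg hq).mul_left _)
  filter_upwards [h] with ω ⟨C, hC, hω⟩
  refine ⟨C ^ (1 / p), by positivity, fun i => ?_⟩
  have hT : (0 : ℝ) < (i : ℝ) + 1 := by positivity
  have h1 : ‖ζ i ω‖ ^ p ≤ C * ((i : ℝ) + 1) ^ (1 + δ * p) := by
    have := hω i
    rwa [Real.rpow_neg hT.le, ← div_eq_mul_inv, div_le_iff₀ (by positivity)] at this
  calc ‖ζ i ω‖ = (‖ζ i ω‖ ^ p) ^ (1 / p) := by
        rw [← Real.rpow_mul (norm_nonneg _), mul_one_div_cancel hp.ne', Real.rpow_one]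
    _ ≤ (C * ((i : ℝ) + 1) ^ (1 + δ * p)) ^ (1 / p) := by gcongr
    _ = _ := by
      rw [Real.mul_rpow hC (by positivity), ← Real.rpow_mul hT.le]
      congr 2
      field_simp

/-- Kolmogorov's convergence theorem for series of independent centred square integrable random
variables. -/
theorem ae_exists_tendsto_sum_of_iIndepFun [IsProbabilityMeasure P] {X : ℕ → Ω → ℝ}
    (hmeas : ∀ i, Measurable (X i)) (hindep : iIndepFun X P) (hL2 : ∀ i, MemLp (X i) 2 P)
    (hmean : ∀ i, ∫ ω, X i ω ∂P = 0) (hvar : Summable fun i => ∫ ω, X i ω ^ 2 ∂P) :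
    ∀ᵐ ω ∂P, ∃ c, Tendsto (fun t => ∑ i ∈ Finset.range t, X i ω) atTop (𝓝 c) := by
  have hsm : ∀ i, StronglyMeasurable (X i) := fun i => (hmeas i).stronglyMeasurable
  have hint : ∀ i, Integrable (X i) P := fun i => (hL2 i).integrable one_le_two
  set ℱ := Filtration.natural X hsm with hℱ
  -- The sum includes index `t`, so that `S t` is measurable for the natural filtration at `t`; the
  -- shift is undone at the end.
  set S : ℕ → Ω → ℝ := fun t ω => ∑ i ∈ Finset.range (t + 1), X i ω with hS
  have hSeq : ∀ t, S t = ∑ i ∈ Finset.range (t + 1), X i := fun t => by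
    ext ω; simp [hS]
  have hSint : ∀ t, Integrable (S t) P := fun t => integrable_finsetSum _ fun i _ => hint i
  have hadp : StronglyAdapted ℱ S := fun t => by
    rw [hSeq]
    refine Finset.stronglyMeasurable_sum _ fun i hi => ?_
    exact (Filtration.stronglyAdapted_natural hsm i).mono
      (ℱ.mono (Nat.lt_succ_iff.1 (Finset.mem_range.1 hi)))
  have hmart : Martingale S ℱ P := by
    refine martingale_nat hadp hSint fun t => ?_
    have h1 : S (t + 1) = S t + X (t + 1) := by
      ext ω; simp only [hS, Pi.add_apply]; rw [Finset.sum_range_succ _ (t + 1)]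
    have h2 := hindep.condExp_natural_ae_eq_of_lt hsm (Nat.lt_succ_self t)
    rw [h1]
    filter_upwards [condExp_add (hSint t) (hint (t + 1)) (ℱ t), h2] with ω h3 h4
    rw [h3, Pi.add_apply, condExp_of_stronglyMeasurable (ℱ.le t) (hadp t) (hSint t)]
    change _ = S t ω + (P[X (t + 1) | ℱ t]) ω
    rw [show (P[X (t + 1) | ℱ t]) ω = _ from h4, hmean, add_zero]
  have hsq : ∀ t, ∫ ω, S t ω ^ 2 ∂P ≤ ∑' i, ∫ ω, X i ω ^ 2 ∂P := fun t => by
    have hSmean : ∫ ω, S t ω ∂P = 0 := by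
      simp only [hS]
      rw [integral_finsetSum _ fun i _ => hint i]
      exact Finset.sum_eq_zero fun i _ => hmean i
    have hv : ∀ i, Var[X i; P] = ∫ ω, X i ω ^ 2 ∂P := fun i =>
      variance_of_integral_eq_zero (hmeas i).aemeasurable (hmean i)
    have hSv : Var[S t; P] = ∫ ω, S t ω ^ 2 ∂P :=
      variance_of_integral_eq_zero (hSint t).aestronglyMeasurable.aemeasurable hSmean
    rw [← hSv, hSeq, IndepFun.variance_sum (fun i _ => hL2 i)
      (fun i _ j _ hij => hindep.indepFun hij)]
    simp_rw [hv]
    exact hvar.sum_le_tsum _ fun i _ => integral_nonneg fun ω => sq_nonneg _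
  have hSL2 : ∀ t, Integrable (fun ω => S t ω ^ 2) P := fun t => by
    refine MemLp.integrable_sq ?_
    exact memLp_finsetSum _ fun i _ => hL2 i
  have hbdd : ∀ t, eLpNorm (S t) 1 P
      ≤ (Real.toNNReal (1 + ∑' i, ∫ ω, X i ω ^ 2 ∂P) : NNReal) := fun t => by
    rw [eLpNorm_one_eq_lintegral_enorm, ← ofReal_integral_norm_eq_lintegral_enorm (hSint t)]
    refine ENNReal.ofReal_le_ofReal ?_
    calc ∫ ω, ‖S t ω‖ ∂P ≤ ∫ ω, (1 + S t ω ^ 2) ∂P := by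
          refine integral_mono (hSint t).norm ((integrable_const 1).add (hSL2 t)) fun ω => ?_
          change |S t ω| ≤ 1 + S t ω ^ 2
          rw [abs_le]
          constructor <;> nlinarith [sq_nonneg (S t ω - 1), sq_nonneg (S t ω + 1)]
      _ = 1 + ∫ ω, S t ω ^ 2 ∂P := by
          rw [integral_add (integrable_const 1) (hSL2 t)]; simp
      _ ≤ _ := by linarith [hsq t]
  filter_upwards [hmart.submartingale.exists_ae_tendsto_of_bdd hbdd] with ω ⟨c, hc⟩
  exact ⟨c, (tendsto_add_atTop_iff_nat 1).1 hc⟩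

theorem integral_sum_sum_sum {ι : Type*} [Fintype ι] {f : ι → ι → ι → Ω → ℝ}
    (hf : ∀ l n j, Integrable (f l n j) P) :
    ∫ ω, ∑ l, ∑ n, ∑ j, f l n j ω ∂P = ∑ l, ∑ n, ∑ j, ∫ ω, f l n j ω ∂P := by
  rw [integral_finsetSum _ fun l _ => integrable_finsetSum _ fun n _ =>
    integrable_finsetSum _ fun j _ => hf l n j]
  refine Finset.sum_congr rfl fun l _ => ?_
  rw [integral_finsetSum _ fun n _ => integrable_finsetSum _ fun j _ => hf l n j]
  exact Finset.sum_congr rfl fun n _ => integral_finsetSum _ fun j _ => hf l n j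

end General

/-! ### Products of consensus steps along one path. -/

section Transition

variable {N : ℕ}

/-- The product `(I - β(t-1) L(t-1)) ⋯ (I - β(s) L(s)) Π` of the consensus steps from time `s` to
time `t`, applied to the projection `Π` onto the vectors of zero sum. -/
noncomputable def transition (L : ℕ → Fin N → Fin N → ℝ) (β : ℕ → ℝ) (s : ℕ) : ℕ → Fin N → Fin N → ℝ
  | 0 => fun n l => (if n = l then 1 else 0) - 1 / (N : ℝ)
  | t + 1 => fun n l =>
      -- The other branch also supplies the initial value `Π` at time `t + 1 = s`; at earlier times
      -- it is only a default.
      if s ≤ t then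
        transition L β s t n l - β t * ∑ j, L t n j * transition L β s t j l
      else (if n = l then 1 else 0) - 1 / (N : ℝ)

variable {L : ℕ → Fin N → Fin N → ℝ} {β : ℕ → ℝ} {s t : ℕ}

theorem transition_self (n l : Fin N) :
    transition L β s s n l = (if n = l then 1 else 0) - 1 / (N : ℝ) := by
  cases s with
  | zero => rfl
  | succ s => simp [transition]

theorem transition_succ (hst : s ≤ t) (n l : Fin N) :
    transition L β s (t + 1) n l
      = transition L β s t n l - β t * ∑ j, L t n j * transition L β s t j l := by
  simp [transition, hst]

/-- Zero-sum columns are preserved by consensus steps, so coercivity of the mean Laplacian applies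
to them at every time. -/
theorem sum_transition (hL : ∀ i l, ∑ n, L i n l = 0) (hst : s ≤ t) (l : Fin N) :
    ∑ n, transition L β s t n l = 0 := by
  induction t, hst using Nat.le_induction with
  | base =>
    have : (N : ℝ) ≠ 0 := by have := l.pos; positivity
    simp [transition_self, this]
  | succ t hst ih =>
    simp_rw [transition_succ hst]
    rw [Finset.sum_sub_distrib, ih, ← Finset.mul_sum, Finset.sum_comm]
    simp_rw [← Finset.sum_mul, hL]
    simp

theorem laplacian_quadratic_nonneg (Γ : SimpleGraph (Fin N)) (v : Fin N → ℝ) :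
    0 ≤ ∑ n, ∑ l, laplacian Γ n l * (v n * v l) := by
  classical
  have h := (SimpleGraph.posSemidef_lapMatrix ℝ Γ).dotProduct_mulVec_nonneg v
  have e : star v ⬝ᵥ (Γ.lapMatrix ℝ *ᵥ v) = ∑ n, ∑ l, laplacian Γ n l * (v n * v l) := by
    simp only [dotProduct, mulVec, star_trivial, Finset.mul_sum, laplacian]
    refine Finset.sum_congr rfl fun n _ => Finset.sum_congr rfl fun l _ => ?_
    have : ∀ (d : DecidableRel Γ.Adj), @SimpleGraph.lapMatrix _ ℝ _ Γ d _ _ n l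
        = Γ.lapMatrix ℝ n l := fun d => by congr!
    rw [this]; ring
  rwa [e] at h

variable {G : ℕ → SimpleGraph (Fin N)}

theorem sum_sq_transition_succ_le (hβ : 0 ≤ β t) (hβN : β t * (2 * N) ≤ 1) (hst : s ≤ t)
    (hL : ∀ i n l, L i n l = laplacian (G i) n l) :
    ∑ l, ∑ n, transition L β s (t + 1) n l ^ 2
      ≤ ∑ l, ∑ n, transition L β s t n l ^ 2
        - β t * ∑ l, ∑ n, ∑ j, L t n j * (transition L β s t n l * transition L β s t j l) := by
  rw [Finset.mul_sum, ← Finset.sum_sub_distrib]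
  refine Finset.sum_le_sum fun l _ => ?_
  simp_rw [transition_succ hst, hL]
  exact sum_sq_sub_laplacian_le (G t) hβ hβN fun n => transition L β s t n l

/-- Initially there are `N²` entries of size at most one, and the energy never increases. This
pathwise bound gives integrability and is the trivial endpoint of the interpolation in
`ae_transition_le`. -/
theorem sum_sq_transition_le {s₀ : ℕ} (hβ : ∀ i ≥ s₀, 0 ≤ β i)
    (hβN : ∀ i ≥ s₀, β i * (2 * N) ≤ 1) (hs : s₀ ≤ s) (hst : s ≤ t)
    (hL : ∀ i n l, L i n l = laplacian (G i) n l) :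
    ∑ l, ∑ n, transition L β s t n l ^ 2 ≤ (N : ℝ) ^ 2 := by
  induction t, hst using Nat.le_induction with
  | base =>
    have h1 : ∀ n l : Fin N, transition L β s s n l ^ 2 ≤ 1 := fun n l => by
      have h2 : (1 : ℝ) ≤ N := by exact_mod_cast n.pos
      have h3 : 1 / (N : ℝ) ≤ 1 := by rw [div_le_one (by linarith)]; exact h2
      have h4 : 0 ≤ 1 / (N : ℝ) := by positivity
      rw [transition_self]
      split_ifs <;> nlinarith
    calc _ ≤ ∑ l : Fin N, ∑ n : Fin N, (1 : ℝ) :=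
          Finset.sum_le_sum fun l _ => Finset.sum_le_sum fun n _ => h1 n l
      _ = _ := by simp [sq]
  | succ t hst ih =>
    refine (sum_sq_transition_succ_le (hβ t (hs.trans hst)) (hβN t (hs.trans hst)) hst hL).trans
      ((sub_le_self _ (mul_nonneg (hβ t (hs.trans hst)) ?_)).trans ih)
    refine Finset.sum_nonneg fun l _ => ?_
    simp_rw [hL]
    exact laplacian_quadratic_nonneg (G t) fun n => transition L β s t n l

theorem sq_transition_le_sum (n l : Fin N) :
    transition L β s t n l ^ 2 ≤ ∑ l, ∑ n, transition L β s t n l ^ 2 :=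
  (Finset.single_le_sum (f := fun n => transition L β s t n l ^ 2) (fun _ _ => sq_nonneg _)
    (Finset.mem_univ n)).trans (Finset.single_le_sum
      (f := fun l => ∑ n, transition L β s t n l ^ 2)
      (fun _ _ => Finset.sum_nonneg fun _ _ => sq_nonneg _) (Finset.mem_univ l))

/-- The product up to time `t` only involves Laplacians at times before `t`; the explicit σ-algebra
makes it independent of the Laplacian at `t`. -/
theorem measurable_transition_iSup {Ω : Type*} {Γ : ℕ → Ω → SimpleGraph (Fin N)} (s t : ℕ)
    (n l : Fin N) :
    Measurable[⨆ i ∈ {i | i < t}, MeasurableSpace.comap (randomLaplacian Γ i) inferInstance]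
      fun ω => transition (fun i => randomLaplacian Γ i ω) β s t n l := by
  induction t generalizing n l with
  | zero => exact measurable_const
  | succ t ih =>
    by_cases hst : s ≤ t
    · simp_rw [transition_succ hst]
      have h1 : ∀ n l, Measurable[⨆ i ∈ {i | i < t + 1},
          MeasurableSpace.comap (randomLaplacian Γ i) inferInstance]
          fun ω => transition (fun i => randomLaplacian Γ i ω) β s t n l := fun n l =>
        (ih n l).mono (biSup_mono fun i (hi : i < t) => Nat.lt_succ_of_lt hi) le_rfl
      have h2 : ∀ n j, Measurable[⨆ i ∈ {i | i < t + 1},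
          MeasurableSpace.comap (randomLaplacian Γ i) inferInstance]
          fun ω => randomLaplacian Γ t ω n j := fun n j => by
        have h3 : Measurable[MeasurableSpace.comap (randomLaplacian Γ t) inferInstance]
            fun ω => randomLaplacian Γ t ω n j :=
          (measurable_pi_apply j).comp ((measurable_pi_apply n).comp (comap_measurable _))
        exact h3.mono (le_biSup (fun i => MeasurableSpace.comap (randomLaplacian Γ i)
          inferInstance) (show t ∈ {i | i < t + 1} from Nat.lt_succ_self t)) le_rfl
      exact (h1 n l).sub ((Finset.measurable_fun_sum _ fun j _ =>
        (h2 n j).mul (h1 j l)).const_mul _)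
    · have : (fun ω => transition (fun i => randomLaplacian Γ i ω) β s (t + 1) n l)
          = fun _ => (if n = l then 1 else 0) - 1 / (N : ℝ) := by
        ext ω; simp [transition, hst]
      rw [this]
      exact measurable_const

end Transition

/-! ### Mean-square and almost sure contraction of the random products. -/

section RandomTransition

variable {Ω : Type*} [MeasurableSpace Ω] {P : Measure Ω} {N : ℕ}
  {Γ : ℕ → Ω → SimpleGraph (Fin N)} {β : ℕ → ℝ}

theorem measurable_laplacian_entry (hΓ : LinkAssumption P Γ) (i : ℕ) (n l : Fin N) :
    Measurable fun ω => laplacian (Γ i ω) n l :=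
  (measurable_pi_apply l).comp ((measurable_pi_apply n).comp (hΓ.measurable i))

theorem integrable_laplacian_entry [IsProbabilityMeasure P] (hΓ : LinkAssumption P Γ) (i : ℕ)
    (n l : Fin N) : Integrable (fun ω => laplacian (Γ i ω) n l) P :=
  Integrable.of_bound (measurable_laplacian_entry hΓ i n l).aestronglyMeasurable N
    (Eventually.of_forall fun ω => abs_laplacian_le (Γ i ω) n l)

theorem integral_laplacian_entry (hΓ : LinkAssumption P Γ) (i : ℕ) (n l : Fin N) :
    ∫ ω, laplacian (Γ i ω) n l ∂P = meanLaplacian P (Γ 0) n l :=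
  ((hΓ.identDistrib i).comp
    ((measurable_pi_apply l).comp (measurable_pi_apply n))).integral_eq

/-- The constant is `λ₂` for at least two sensors. Otherwise zero-sum vectors vanish and any
constant serves. -/
theorem exists_meanLaplacian_coercive [IsProbabilityMeasure P] (hΓ : LinkAssumption P Γ) :
    ∃ c : ℝ, 0 < c ∧ ∀ v : Fin N → ℝ, ∑ n, v n = 0 →
      c * ∑ n, v n ^ 2 ≤ ∑ n, ∑ j, meanLaplacian P (Γ 0) n j * (v n * v j) := by
  by_cases hN : 2 ≤ N
  · refine ⟨_, hΓ.connected_mean hN, fun v hv => ?_⟩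
    have h1 : meanLaplacian P (Γ 0) *ᵥ 1 = 0 := by
      ext n
      simp only [mulVec, dotProduct, Pi.one_apply, mul_one, Pi.zero_apply, meanLaplacian, of_apply]
      rw [← integral_finsetSum _ fun l _ => integrable_laplacian_entry hΓ 0 n l]
      simp [sum_laplacian_row]
    have h := lambda2_mul_le hN (meanLaplacian_isHermitian P (Γ 0)) h1 (hΓ.connected_mean hN) hv
    have e1 : v ⬝ᵥ v = ∑ n, v n ^ 2 := by simp [dotProduct, sq]
    have e2 : v ⬝ᵥ (meanLaplacian P (Γ 0) *ᵥ v)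
        = ∑ n, ∑ j, meanLaplacian P (Γ 0) n j * (v n * v j) := by
      simp only [dotProduct, mulVec, Finset.mul_sum]
      exact Finset.sum_congr rfl fun n _ => Finset.sum_congr rfl fun l _ => by ring
    rwa [e1, e2] at h
  · refine ⟨1, one_pos, fun v hv => ?_⟩
    have hv0 : ∀ n, v n = 0 := fun n => by
      have : Subsingleton (Fin N) := Fin.subsingleton_iff_le_one.2 (by omega)
      rwa [Fintype.sum_subsingleton _ n] at hv
    simp [hv0]

theorem measurable_transition (hΓ : LinkAssumption P Γ) (s t : ℕ) (n l : Fin N) :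
    Measurable fun ω => transition (fun i => randomLaplacian Γ i ω) β s t n l :=
  (measurable_transition_iSup s t n l).mono
    (iSup₂_le fun i _ => (hΓ.measurable i).comap_le) le_rfl

theorem indepFun_laplacian_transition (hΓ : LinkAssumption P Γ) (s t : ℕ) (n j p q : Fin N) :
    IndepFun (fun ω => randomLaplacian Γ t ω n j)
      (fun ω => transition (fun i => randomLaplacian Γ i ω) β s t n p
        * transition (fun i => randomLaplacian Γ i ω) β s t j q) P := by
  rw [IndepFun_iff_Indep]
  have h := indep_iSup_of_disjoint (fun i => (hΓ.measurable i).comap_le)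
    ((iIndepFun_iff_iIndep _ _ _).1 hΓ.indep) (S := {t}) (T := {i | i < t}) (by simp)
  rw [iSup_singleton] at h
  refine indep_of_indep_of_le_left (indep_of_indep_of_le_right h ?_) ?_
  · exact ((measurable_transition_iSup s t n p).mul (measurable_transition_iSup s t j q)).comap_le
  · have h3 : Measurable[MeasurableSpace.comap (randomLaplacian Γ t) inferInstance]
        fun ω => randomLaplacian Γ t ω n j :=
      (measurable_pi_apply j).comp ((measurable_pi_apply n).comp (comap_measurable _))
    exact h3.comap_le

theorem integrable_sum_sq_transition [IsProbabilityMeasure P] (hΓ : LinkAssumption P Γ) {s₀ : ℕ}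
    (hβ : ∀ i ≥ s₀, 0 ≤ β i) (hβN : ∀ i ≥ s₀, β i * (2 * N) ≤ 1) {s t : ℕ} (hs : s₀ ≤ s)
    (hst : s ≤ t) : Integrable (fun ω => ∑ l, ∑ n,
      transition (fun i => randomLaplacian Γ i ω) β s t n l ^ 2) P := by
  refine Integrable.of_bound (Finset.measurable_fun_sum _ fun l _ => Finset.measurable_fun_sum _
    fun n _ => (measurable_transition hΓ s t n l).pow_const 2).aestronglyMeasurable ((N : ℝ) ^ 2)
    (Eventually.of_forall fun ω => ?_)
  rw [Real.norm_of_nonneg (Finset.sum_nonneg fun _ _ => Finset.sum_nonneg fun _ _ => sq_nonneg _)]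
  exact sum_sq_transition_le hβ hβN hs hst (G := fun i => Γ i ω) fun _ _ _ => rfl

theorem integral_sum_sq_transition_le [IsProbabilityMeasure P] (hΓ : LinkAssumption P Γ) {s₀ : ℕ}
    (hβ : ∀ i ≥ s₀, 0 ≤ β i) (hβN : ∀ i ≥ s₀, β i * (2 * N) ≤ 1) {c : ℝ}
    (hc : ∀ v : Fin N → ℝ, ∑ n, v n = 0 →
      c * ∑ n, v n ^ 2 ≤ ∑ n, ∑ j, meanLaplacian P (Γ 0) n j * (v n * v j))
    (hcβ : ∀ i ≥ s₀, c * β i ≤ 1) {s t : ℕ} (hs : s₀ ≤ s) (hst : s ≤ t) :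
    ∫ ω, ∑ l, ∑ n, transition (fun i => randomLaplacian Γ i ω) β s t n l ^ 2 ∂P
      ≤ (N : ℝ) ^ 2 * ∏ i ∈ Finset.Ico s t, (1 - c * β i) := by
  induction t, hst using Nat.le_induction with
  | base =>
    calc _ ≤ ∫ _, (N : ℝ) ^ 2 ∂P := by
          refine integral_mono (integrable_sum_sq_transition hΓ hβ hβN hs le_rfl)
            (integrable_const _) fun ω => ?_
          exact sum_sq_transition_le hβ hβN hs le_rfl (G := fun i => Γ i ω) fun _ _ _ => rfl
      _ = _ := by simp
  | succ t hst ih =>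
    have ht : s₀ ≤ t := hs.trans hst
    set Φ : Ω → Fin N → Fin N → ℝ := fun ω => transition (fun i => randomLaplacian Γ i ω) β s t
    have hΦm : ∀ n l, Measurable fun ω => Φ ω n l := fun n l => measurable_transition hΓ s t n l
    have hΦb : ∀ n l ω, |Φ ω n l| ≤ N := fun n l ω =>
      abs_le_of_sq_le_sq ((sq_transition_le_sum n l).trans
        (sum_sq_transition_le hβ hβN hs hst (G := fun i => Γ i ω) fun _ _ _ => rfl))
        (Nat.cast_nonneg N)
    have hΦΦm : ∀ n j l, Measurable fun ω => Φ ω n l * Φ ω j l := fun n j l =>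
      (hΦm n l).mul (hΦm j l)
    have hΦΦb : ∀ n j l ω, |Φ ω n l * Φ ω j l| ≤ (N : ℝ) * N := fun n j l ω => by
      rw [abs_mul]
      exact mul_le_mul (hΦb n l ω) (hΦb j l ω) (abs_nonneg _) (Nat.cast_nonneg N)
    have hΦΦi : ∀ n j l, Integrable (fun ω => Φ ω n l * Φ ω j l) P := fun n j l =>
      Integrable.of_bound (hΦΦm n j l).aestronglyMeasurable _
        (Eventually.of_forall fun ω => hΦΦb n j l ω)
    have hLi : ∀ n j l, Integrable (fun ω => randomLaplacian Γ t ω n j * (Φ ω n l * Φ ω j l)) P :=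
      fun n j l => (hΦΦi n j l).bdd_mul (measurable_laplacian_entry hΓ t n j).aestronglyMeasurable
        (Eventually.of_forall fun ω => abs_laplacian_le (Γ t ω) n j)
    have hFi := integrable_sum_sq_transition hΓ hβ hβN hs hst (P := P)
    have hQi : Integrable (fun ω => ∑ l, ∑ n, ∑ j,
        randomLaplacian Γ t ω n j * (Φ ω n l * Φ ω j l)) P :=
      integrable_finsetSum _ fun l _ => integrable_finsetSum _ fun n _ =>
        integrable_finsetSum _ fun j _ => hLi n j l
    -- Independence from the past, applied entry by entry, replaces the Laplacian by its mean under
    -- the integral; coercivity then holds pointwise on each zero-sum column.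
    have hQ : c * ∫ ω, ∑ l, ∑ n, Φ ω n l ^ 2 ∂P
        ≤ ∫ ω, ∑ l, ∑ n, ∑ j, randomLaplacian Γ t ω n j * (Φ ω n l * Φ ω j l) ∂P := by
      have e : ∫ ω, ∑ l, ∑ n, ∑ j, randomLaplacian Γ t ω n j * (Φ ω n l * Φ ω j l) ∂P
          = ∫ ω, ∑ l, ∑ n, ∑ j, meanLaplacian P (Γ 0) n j * (Φ ω n l * Φ ω j l) ∂P := by
        refine (integral_sum_sum_sum fun l n j => hLi n j l).trans (Eq.trans ?_
          (integral_sum_sum_sum fun l n j =>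
            (hΦΦi n j l).const_mul (meanLaplacian P (Γ 0) n j)).symm)
        refine Finset.sum_congr rfl fun l _ => Finset.sum_congr rfl fun n _ =>
          Finset.sum_congr rfl fun j _ => ?_
        rw [(indepFun_laplacian_transition hΓ s t n j l l).integral_fun_mul_eq_mul_integral
          (measurable_laplacian_entry hΓ t n j).aestronglyMeasurable
          (hΦΦm n j l).aestronglyMeasurable, integral_const_mul]
        exact congrArg (· * _) (integral_laplacian_entry hΓ t n j)
      rw [e, ← integral_const_mul]
      refine integral_mono (hFi.const_mul c) (integrable_finsetSum _ fun l _ =>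
        integrable_finsetSum _ fun n _ => integrable_finsetSum _ fun j _ =>
          (hΦΦi n j l).const_mul _) fun ω => ?_
      change c * ∑ l, ∑ n, Φ ω n l ^ 2 ≤ _
      rw [Finset.mul_sum]
      exact Finset.sum_le_sum fun l _ => hc _
        (sum_transition (fun i l => sum_laplacian_col (Γ i ω) l) hst l)
    calc _ ≤ ∫ ω, (∑ l, ∑ n, Φ ω n l ^ 2
            - β t * ∑ l, ∑ n, ∑ j, randomLaplacian Γ t ω n j * (Φ ω n l * Φ ω j l)) ∂P := by
          refine integral_mono (integrable_sum_sq_transition hΓ hβ hβN hs (hst.trans t.le_succ))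
            (hFi.sub (hQi.const_mul _)) fun ω => ?_
          exact sum_sq_transition_succ_le (hβ t ht) (hβN t ht) hst (G := fun i => Γ i ω)
            fun _ _ _ => rfl
      _ = ∫ ω, ∑ l, ∑ n, Φ ω n l ^ 2 ∂P - β t *
            ∫ ω, ∑ l, ∑ n, ∑ j, randomLaplacian Γ t ω n j * (Φ ω n l * Φ ω j l) ∂P := by
          rw [integral_sub hFi (hQi.const_mul _), integral_const_mul]
      _ ≤ (1 - c * β t) * ∫ ω, ∑ l, ∑ n, Φ ω n l ^ 2 ∂P := by
          have := mul_le_mul_of_nonneg_left hQ (hβ t ht)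
          linarith
      _ ≤ (1 - c * β t) * ((N : ℝ) ^ 2 * ∏ i ∈ Finset.Ico s t, (1 - c * β i)) :=
          mul_le_mul_of_nonneg_left ih (by linarith [hcβ t ht])
      _ = _ := by rw [Finset.prod_Ico_succ_top hst]; ring

/-- Almost surely, the products of the random consensus steps contract at the rate of the mean
network, up to a polynomial factor of arbitrarily small order. -/
theorem ae_transition_le [IsProbabilityMeasure P] (hΓ : LinkAssumption P Γ) (hβ : ∀ i, 0 < β i)
    (hβ0 : Tendsto β atTop (𝓝 0)) {δ : ℝ} (hδ : 0 < δ) :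
    ∃ c : ℝ, 0 < c ∧ ∃ s₀ : ℕ, (∀ i ≥ s₀, c * β i ≤ 1) ∧
      ∀ᵐ ω ∂P, ∃ C : ℝ, 0 ≤ C ∧ ∀ s ≥ s₀, ∀ t ≥ s, ∀ n l,
        |transition (fun i => randomLaplacian Γ i ω) β s t n l|
          ≤ C * ((t : ℝ) + 1) ^ δ * ∏ i ∈ Finset.Ico s t, (1 - c * β i) := by
  obtain ⟨c, hc0, hc⟩ := exists_meanLaplacian_coercive hΓ
  have hev1 : ∀ᶠ i in atTop, β i * (2 * N) ≤ 1 := by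
    have h := hβ0.mul_const (2 * (N : ℝ))
    rw [zero_mul] at h
    exact h.eventually (Iic_mem_nhds one_pos)
  -- The bound `1 / 2` instead of `1` keeps the products positive, so one may divide by them.
  have hev2 : ∀ᶠ i in atTop, c * β i ≤ 1 / 2 := by
    have h := hβ0.const_mul c
    rw [mul_zero] at h
    exact h.eventually (Iic_mem_nhds (by norm_num))
  obtain ⟨s₀, hs₀⟩ := eventually_atTop.1 (hev1.and hev2)
  have hβN : ∀ i ≥ s₀, β i * (2 * N) ≤ 1 := fun i hi => (hs₀ i hi).1
  have hcβ : ∀ i ≥ s₀, c * β i ≤ 1 / 2 := fun i hi => (hs₀ i hi).2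
  -- Interpolation exponent: an entry `f` is written `f ^ (1 - 2η) * (f²) ^ η`, with `N` bounding
  -- the first factor. The union over pairs costs `(t + 1) ^ 4`, which becomes `(t + 1) ^ (4η)`, and
  -- the rate `c` drops to `η c`.
  set η := min (δ / 4) (1 / 2) with hη
  have hη0 : 0 < η := lt_min (by positivity) (by norm_num)
  have hη1 : η ≤ 1 / 2 := min_le_right _ _
  have hη2 : 4 * η ≤ δ := by linarith [min_le_left (δ / 4) (1 / 2 : ℝ)]
  set F : ℕ → ℕ → Ω → ℝ := fun s t ω =>
    ∑ l, ∑ n, transition (fun i => randomLaplacian Γ i ω) β s t n l ^ 2 with hF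
  have hF0 : ∀ s t ω, 0 ≤ F s t ω := fun s t ω =>
    Finset.sum_nonneg fun _ _ => Finset.sum_nonneg fun _ _ => sq_nonneg _
  have hprod : ∀ s ≥ s₀, ∀ t, 0 < ∏ i ∈ Finset.Ico s t, (1 - c * β i) := fun s hs t =>
    Finset.prod_pos fun i hi => by linarith [hcβ i (hs.le.trans (Finset.mem_Ico.1 hi).1)]
  refine ⟨η * c, by positivity, s₀, fun i hi => ?_, ?_⟩
  · have : 0 < c * β i := mul_pos hc0 (hβ i)
    nlinarith [hcβ i hi]
  -- Summable over pairs, and at least `(t + 1) ^ (-4)` for `s ≤ t`: one random constant serves all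
  -- pairs, with a loss depending on `t` only.
  set W : ℕ × ℕ → ℝ := fun p => ((p.1 : ℝ) + 1) ^ (-2 : ℝ) * ((p.2 : ℝ) + 1) ^ (-2 : ℝ) with hW
  have hWsum : Summable W := (summable_rpow_neg one_lt_two).mul_of_nonneg
    (summable_rpow_neg one_lt_two) (fun _ => by positivity) (fun _ => by positivity)
  have hbound := ae_exists_bound_of_summable_integral (P := P) (ι := ℕ × ℕ)
    (f := fun p ω => if s₀ ≤ p.1 ∧ p.1 ≤ p.2 then
      F p.1 p.2 ω * (W p / ∏ i ∈ Finset.Ico p.1 p.2, (1 - c * β i)) else 0)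
    (fun p ω => by
      split_ifs with h
      · exact mul_nonneg (hF0 _ _ _) (div_nonneg (by positivity) (hprod _ h.1 _).le)
      · exact le_rfl)
    (fun p => by
      split_ifs with h
      · exact (integrable_sum_sq_transition hΓ (fun i _ => (hβ i).le) hβN h.1 h.2).mul_const _
      · exact integrable_zero _ _ _)
    (by
      refine Summable.of_nonneg_of_le (fun p => ?_) (fun p => ?_) (hWsum.mul_left ((N : ℝ) ^ 2))
      · refine integral_nonneg fun ω => ?_
        change 0 ≤ ite _ _ _
        split_ifs with h
        · exact mul_nonneg (hF0 _ _ _) (div_nonneg (by positivity) (hprod _ h.1 _).le)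
        · exact le_rfl
      · split_ifs with h
        · rw [integral_mul_const]
          have h1 := integral_sum_sq_transition_le hΓ (fun i _ => (hβ i).le) hβN hc
            (fun i hi => (hcβ i hi).trans (by norm_num)) h.1 h.2
          have h2 := hprod _ h.1 p.2
          calc _ ≤ ((N : ℝ) ^ 2 * ∏ i ∈ Finset.Ico p.1 p.2, (1 - c * β i))
                * (W p / ∏ i ∈ Finset.Ico p.1 p.2, (1 - c * β i)) :=
                mul_le_mul_of_nonneg_right h1 (div_nonneg (by positivity) h2.le)
            _ = _ := by field_simp
        · rw [integral_zero]; positivity)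
  filter_upwards [hbound] with ω ⟨B, hB, hω⟩
  refine ⟨(N : ℝ) ^ (1 - 2 * η) * B ^ η, by positivity, fun s hs t hst n l => ?_⟩
  have hT : (1 : ℝ) ≤ (t : ℝ) + 1 := by linarith [(Nat.cast_nonneg t : (0 : ℝ) ≤ t)]
  have hpr := hprod s hs t
  set Q := ∏ i ∈ Finset.Ico s t, (1 - c * β i) with hQ
  have hFB : F s t ω ≤ B * ((t : ℝ) + 1) ^ (4 : ℝ) * Q := by
    have h1 := hω (s, t)
    rw [if_pos ⟨hs, hst⟩] at h1
    have hs1 : ((s : ℝ) + 1) ≤ (t : ℝ) + 1 := by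
      have : (s : ℝ) ≤ t := by exact_mod_cast hst
      linarith
    have hW4 : ((t : ℝ) + 1) ^ (-4 : ℝ) ≤ W (s, t) := by
      have : ((t : ℝ) + 1) ^ (-4 : ℝ) = ((t : ℝ) + 1) ^ (-2 : ℝ) * ((t : ℝ) + 1) ^ (-2 : ℝ) := by
        rw [← Real.rpow_add (by positivity)]; norm_num
      rw [this]
      have h2 : ((t : ℝ) + 1) ^ (-2 : ℝ) ≤ ((s : ℝ) + 1) ^ (-2 : ℝ) :=
        Real.rpow_le_rpow_of_nonpos (by positivity) hs1 (by norm_num)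
      exact mul_le_mul_of_nonneg_right h2 (by positivity)
    have h3 : F s t ω * (((t : ℝ) + 1) ^ (-4 : ℝ) / Q) ≤ B :=
      (mul_le_mul_of_nonneg_left (by gcongr) (hF0 s t ω)).trans h1
    rw [Real.rpow_neg (by positivity), inv_eq_one_div, div_div, mul_one_div,
      div_le_iff₀ (by positivity)] at h3
    linarith
  set f := |transition (fun i => randomLaplacian Γ i ω) β s t n l| with hf
  have hf0 : 0 ≤ f := abs_nonneg _
  have hfF : f ^ 2 ≤ F s t ω := by rw [hf, sq_abs]; exact sq_transition_le_sum n l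
  have hfN : f ≤ N := abs_le_of_sq_le_sq ((sq_transition_le_sum n l).trans
        (sum_sq_transition_le (fun i _ => (hβ i).le) hβN hs hst (G := fun i => Γ i ω)
          fun _ _ _ => rfl)) (Nat.cast_nonneg N)
  -- Bernoulli for an exponent at most one: `(1 - x) ^ η ≤ 1 - η x`.
  have hQη : Q ^ η ≤ ∏ i ∈ Finset.Ico s t, (1 - η * c * β i) := by
    rw [hQ, ← Real.finsetProd_rpow _ _ fun i hi => ?_]
    · refine Finset.prod_le_prod (fun i hi => ?_) fun i hi => ?_
      · have := hcβ i (hs.le.trans (Finset.mem_Ico.1 hi).1)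
        exact Real.rpow_nonneg (by linarith) _
      · have h1 := hcβ i (hs.le.trans (Finset.mem_Ico.1 hi).1)
        have h2 := rpow_one_add_le_one_add_mul_self (s := -(c * β i)) (by linarith) hη0.le
          (by linarith : η ≤ 1)
        rw [← sub_eq_add_neg] at h2
        linarith
    · have := hcβ i (hs.le.trans (Finset.mem_Ico.1 hi).1)
      linarith
  calc f = f ^ (1 - 2 * η) * (f ^ 2) ^ η := by
        rcases hf0.eq_or_lt with h | h
        · rw [← h, sq, mul_zero, Real.zero_rpow hη0.ne', mul_zero]
        · rw [← Real.rpow_natCast f 2, ← Real.rpow_mul hf0, ← Real.rpow_add h]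
          norm_num
    _ ≤ (N : ℝ) ^ (1 - 2 * η) * (B * ((t : ℝ) + 1) ^ (4 : ℝ) * Q) ^ η := by
        have h1 : 0 ≤ 1 - 2 * η := by linarith
        have h2 := hfF.trans hFB
        gcongr
    _ = (N : ℝ) ^ (1 - 2 * η) * B ^ η * ((t : ℝ) + 1) ^ (4 * η) * Q ^ η := by
        rw [Real.mul_rpow (by positivity) hpr.le, Real.mul_rpow hB (by positivity),
          ← Real.rpow_mul (by positivity)]
        ring
    _ ≤ (N : ℝ) ^ (1 - 2 * η) * B ^ η * ((t : ℝ) + 1) ^ δ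
          * ∏ i ∈ Finset.Ico s t, (1 - η * c * β i) := by
        have : 0 ≤ Q ^ η := by positivity
        gcongr

end RandomTransition

/-! ### Pathwise analysis of the vector recursions. -/

section Deterministic

variable {E : Type*} [NormedAddCommGroup E] [InnerProductSpace ℝ E]

/-- A contracting linear recursion driven by a convergent series tends to `0`. -/
theorem tendsto_zero_of_convergent_input {T : E →L[ℝ] E} {d ξ : ℕ → E} {α : ℕ → ℝ} {μ : ℝ}
    {ℓ : E} (hμ : 0 < μ) (hα : ∀ t, 0 ≤ α t) (hα0 : Tendsto α atTop (𝓝 0))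
    (hαsum : Tendsto (fun t => ∑ i ∈ Finset.range t, α i) atTop atTop)
    (hT : ∀ᶠ t in atTop, ∀ v, ‖v - α t • T v‖ ≤ (1 - α t * μ) * ‖v‖)
    (hξ : Tendsto (fun t => ∑ i ∈ Finset.range t, ξ i) atTop (𝓝 ℓ))
    (hd : ∀ t, d (t + 1) = d t - α t • T (d t) + ξ t) : Tendsto d atTop (𝓝 0) := by
  -- Adding the tail of the series to `d` removes the input `ξ` and leaves `α t • T (r t)`, a null
  -- sequence times the gain.
  set r : ℕ → E := fun t => ℓ - ∑ i ∈ Finset.range t, ξ i with hr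
  have hr0 : Tendsto r atTop (𝓝 0) := by simpa using hξ.const_sub ℓ
  have hstep : ∀ t, d (t + 1) + r (t + 1)
      = ((d t + r t) - α t • T (d t + r t)) + α t • T (r t) := fun t => by
    rw [hd, map_add, smul_add]
    simp only [hr, Finset.sum_range_succ]
    abel
  have hlim : Tendsto (fun t => d t + r t) atTop (𝓝 0) := by
    rw [tendsto_zero_iff_norm_tendsto_zero]
    refine tendsto_zero_of_recursion (a := fun t => α t * μ) (e := fun t => ‖T (r t)‖ / μ)
      (fun t => norm_nonneg _) (Eventually.of_forall fun t => mul_nonneg (hα t) hμ.le) ?_ ?_ ?_ ?_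
    · have h := hα0.mul_const μ
      rw [zero_mul] at h
      exact h.eventually (Iic_mem_nhds one_pos)
    · simp_rw [← Finset.sum_mul]
      exact hαsum.atTop_mul_const hμ
    · have h := ((T.continuous.tendsto 0).comp hr0).norm.div_const μ
      simpa using h
    · filter_upwards [hT] with t ht
      rw [hstep]
      refine (norm_add_le _ _).trans (add_le_add (ht _) ?_)
      rw [norm_smul, Real.norm_of_nonneg (hα t)]
      exact le_of_eq (by field_simp)
  simpa using hlim.sub hr0

variable {N : ℕ} {L : ℕ → Fin N → Fin N → ℝ} {α β : ℕ → ℝ}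

theorem sum_transition_succ_smul {s t : ℕ} (hst : s ≤ t) (v : Fin N → E) (n : Fin N) :
    ∑ l, transition L β s (t + 1) n l • v l
      = ∑ l, transition L β s t n l • v l
        - β t • ∑ j, L t n j • ∑ l, transition L β s t j l • v l := by
  simp_rw [transition_succ hst, sub_smul, Finset.sum_sub_distrib, Finset.smul_sum, mul_smul,
    Finset.sum_smul, Finset.smul_sum]
  congr 1
  rw [Finset.sum_comm]
  simp_rw [mul_smul]

theorem sum_transition_self_smul (s : ℕ) (v : Fin N → E) (n : Fin N) :
    ∑ l, transition L β s s n l • v l = v n - (1 / (N : ℝ)) • ∑ l, v l := by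
  simp_rw [transition_self, sub_smul, Finset.sum_sub_distrib, ite_smul, one_smul, zero_smul,
    Finset.sum_ite_eq, Finset.mem_univ, if_true, Finset.smul_sum]

theorem sum_consensus_step (hcol : ∀ t l, ∑ n, L t n l = 0) (t : ℕ) (v w : Fin N → E) :
    ∑ n, (v n - β t • ∑ l, L t n l • v l + w n) = ∑ n, v n + ∑ n, w n := by
  rw [Finset.sum_add_distrib, Finset.sum_sub_distrib, ← Finset.smul_sum, Finset.sum_comm]
  simp_rw [← Finset.sum_smul, hcol]
  simp

/-- The deviation from the network average, by variation of constants. -/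
theorem sub_average_eq {x J : ℕ → Fin N → E} (hrow : ∀ t n, ∑ l, L t n l = 0)
    (hcol : ∀ t l, ∑ n, L t n l = 0)
    (hx : ∀ t n, x (t + 1) n = x t n - β t • ∑ l, L t n l • x t l + α t • J t n)
    {s t : ℕ} (hst : s ≤ t) (n : Fin N) :
    x t n - (1 / (N : ℝ)) • ∑ l, x t l = ∑ l, transition L β s t n l • x s l
      + ∑ r ∈ Finset.Ico s t, α r • ∑ l, transition L β (r + 1) t n l • J r l := by
  induction t, hst using Nat.le_induction generalizing n with
  | base => simp [sum_transition_self_smul]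
  | succ t hst ih =>
    have hR : ∀ r ∈ Finset.Ico s t, α r • ∑ l, transition L β (r + 1) (t + 1) n l • J r l
        = α r • ∑ l, transition L β (r + 1) t n l • J r l
          - β t • ∑ j, L t n j • α r • ∑ l, transition L β (r + 1) t j l • J r l := fun r hr => by
      have h : ∀ S : Fin N → E, α r • ∑ j, L t n j • S j = ∑ j, L t n j • α r • S j := fun S => by
        rw [Finset.smul_sum]
        exact Finset.sum_congr rfl fun j _ => smul_comm _ _ _
      rw [sum_transition_succ_smul (show r + 1 ≤ t from (Finset.mem_Ico.1 hr).2), smul_sub,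
        smul_comm (α r) (β t), h]
    -- Zero row sums let the Laplacian act on deviations from the average, so the induction
    -- hypothesis applies.
    have hLavg : ∑ j, L t n j • x t j = ∑ j, L t n j • (x t j - (1 / (N : ℝ)) • ∑ l, x t l) := by
      simp_rw [smul_sub, Finset.sum_sub_distrib, ← Finset.sum_smul, hrow, zero_smul, sub_zero]
    have hsum : ∑ l, x (t + 1) l = ∑ l, x t l + ∑ l, α t • J t l := by
      simp_rw [hx]
      exact sum_consensus_step hcol t (x t) fun l => α t • J t l
    rw [Finset.sum_Ico_succ_top hst, Finset.sum_congr rfl hR, Finset.sum_sub_distrib,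
      sum_transition_succ_smul hst, sum_transition_self_smul, hsum, hx, hLavg]
    simp_rw [ih, smul_add, Finset.sum_add_distrib, smul_sub, smul_add, Finset.smul_sum]
    have := ih n
    rw [sub_eq_iff_eq_add] at this
    rw [this]
    have hcomm : ∑ r ∈ Finset.Ico s t, ∑ j, ∑ l, β t • L t n j • α r •
          transition L β (r + 1) t j l • J r l
        = ∑ j, ∑ r ∈ Finset.Ico s t, ∑ l, β t • L t n j • α r •
          transition L β (r + 1) t j l • J r l := Finset.sum_comm
    rw [hcomm]
    simp_rw [Finset.smul_sum, smul_comm (1 / (N : ℝ)) (α t)]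
    abel

/-- If the transition matrices contract up to a polynomial factor, the disagreement is dominated
by a scalar recursion. -/
theorem exists_disagreement_envelope {x J : ℕ → Fin N → E} (hrow : ∀ t n, ∑ l, L t n l = 0)
    (hcol : ∀ t l, ∑ n, L t n l = 0)
    (hx : ∀ t n, x (t + 1) n = x t n - β t • ∑ l, L t n l • x t l + α t • J t n)
    (hα : ∀ t, 0 ≤ α t) {c C δ : ℝ} {s₀ : ℕ} (hcβ : ∀ i ≥ s₀, c * β i ≤ 1)
    (hΦ : ∀ s ≥ s₀, ∀ t ≥ s, ∀ n l, |transition L β s t n l|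
      ≤ C * ((t : ℝ) + 1) ^ δ * ∏ i ∈ Finset.Ico s t, (1 - c * β i)) :
    ∃ y : ℕ → ℝ, (∀ t ≥ s₀, 0 ≤ y t) ∧
      (∀ t ≥ s₀, y (t + 1) = (1 - c * β t) * y t + α t * ∑ l, ‖J t l‖) ∧
      ∀ t ≥ s₀, ∑ n, ‖x t n - (1 / (N : ℝ)) • ∑ l, x t l‖
        ≤ N * C * ((t : ℝ) + 1) ^ δ * y t := by
  set Q : ℕ → ℕ → ℝ := fun s t => ∏ i ∈ Finset.Ico s t, (1 - c * β i) with hQ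
  have hQ0 : ∀ s ≥ s₀, ∀ t, 0 ≤ Q s t := fun s hs t => Finset.prod_nonneg fun i hi => by
    linarith [hcβ i (hs.le.trans (Finset.mem_Ico.1 hi).1)]
  have hΦsum : ∀ s ≥ s₀, ∀ t ≥ s, ∀ n (v : Fin N → E),
      ‖∑ l, transition L β s t n l • v l‖ ≤ C * ((t : ℝ) + 1) ^ δ * (Q s t * ∑ l, ‖v l‖) := by
    intro s hs t ht n v
    rw [← mul_assoc, Finset.mul_sum]
    refine norm_sum_le_of_le _ fun l _ => ?_
    rw [norm_smul, Real.norm_eq_abs]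
    exact mul_le_mul_of_nonneg_right (hΦ s hs t ht n l) (norm_nonneg _)
  -- The envelope is the variation-of-constants formula with transition matrices replaced by scalar
  -- products. It satisfies an exact recursion because the factor `(t + 1) ^ δ`, which does not
  -- depend on the starting time, stays outside.
  refine ⟨fun t => Q s₀ t * ∑ l, ‖x s₀ l‖
    + ∑ r ∈ Finset.Ico s₀ t, α r * (Q (r + 1) t * ∑ l, ‖J r l‖), fun t ht => ?_, fun t ht => ?_,
    fun t ht => ?_⟩
  · refine add_nonneg (mul_nonneg (hQ0 _ le_rfl _) (Finset.sum_nonneg fun _ _ => norm_nonneg _))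
      (Finset.sum_nonneg fun r hr => mul_nonneg (hα r) (mul_nonneg (hQ0 _ ?_ _)
        (Finset.sum_nonneg fun _ _ => norm_nonneg _)))
    exact (Finset.mem_Ico.1 hr).1.trans r.le_succ
  · have h1 : ∀ s ≤ t, Q s (t + 1) = Q s t * (1 - c * β t) := fun s hs =>
      Finset.prod_Ico_succ_top hs _
    have h2 : Q (t + 1) (t + 1) = 1 := by simp [hQ]
    have h3 : ∀ r ∈ Finset.Ico s₀ t, α r * (Q (r + 1) (t + 1) * ∑ l, ‖J r l‖)
        = (1 - c * β t) * (α r * (Q (r + 1) t * ∑ l, ‖J r l‖)) := fun r hr => by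
      rw [h1 (r + 1) (Finset.mem_Ico.1 hr).2]; ring
    simp only
    rw [Finset.sum_Ico_succ_top ht, h1 s₀ ht, h2, mul_add, Finset.mul_sum (Finset.Ico s₀ t),
      Finset.sum_congr rfl h3]
    ring
  · have h1 : ∀ n, ‖x t n - (1 / (N : ℝ)) • ∑ l, x t l‖ ≤ C * ((t : ℝ) + 1) ^ δ *
        (Q s₀ t * ∑ l, ‖x s₀ l‖
          + ∑ r ∈ Finset.Ico s₀ t, α r * (Q (r + 1) t * ∑ l, ‖J r l‖)) := fun n => by
      rw [sub_average_eq hrow hcol hx ht n, mul_add, Finset.mul_sum (Finset.Ico s₀ t)]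
      refine (norm_add_le _ _).trans (add_le_add (hΦsum _ le_rfl _ ht _ _)
        (norm_sum_le_of_le _ fun r hr => ?_))
      have hr' := Finset.mem_Ico.1 hr
      rw [norm_smul, Real.norm_of_nonneg (hα r), mul_left_comm]
      exact mul_le_mul_of_nonneg_left (hΦsum _ (hr'.1.trans r.le_succ) _ hr'.2 _ _) (hα r)
    refine (Finset.sum_le_sum fun n _ => h1 n).trans_eq ?_
    simp only [Finset.sum_const, Finset.card_univ, Fintype.card_fin, nsmul_eq_mul]
    ring

/-- Pathwise comparison of a consensus + innovations recursion with the centralized recursion. -/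
theorem tendsto_consensus_sub_centralized (hN : 0 < N) {x η : ℕ → Fin N → E} {u : ℕ → E} {θ : E}
    {A : Fin N → E →L[ℝ] E} {τ₁ τ₂ τ₀ a b μ ρ δ c C Cη Cu : ℝ} {s₀ : ℕ}
    (hrow : ∀ t n, ∑ l, L t n l = 0) (hcol : ∀ t l, ∑ n, L t n l = 0)
    (hx : ∀ t n, x (t + 1) n = x t n - weight b τ₂ t • ∑ l, L t n l • x t l
      + weight a τ₁ t • (η t n - A n (x t n - θ)))
    (hu : ∀ t, u (t + 1) = u t + (weight a τ₁ t / N) • ∑ n, (η t n - A n (u t - θ)))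
    (hτ₁ : τ₁ ≤ 1) (hτ₂ : 0 < τ₂) (ha : 0 < a) (hb : 0 < b) (hρ : 0 ≤ ρ) (hδ : 0 < δ)
    (hμ : 0 < μ) (hτ₀ : 0 ≤ τ₀) (hrate : τ₀ < τ₁ - τ₂ - ρ - δ) (hrate1 : τ₁ = 1 → τ₀ < a * μ)
    (hcontr : ∀ᶠ t in atTop, ∀ v : E,
      ‖v - (weight a τ₁ t / N) • ∑ n, A n v‖ ≤ (1 - weight a τ₁ t * μ) * ‖v‖)
    (hCη : 0 ≤ Cη) (hη : ∀ (t : ℕ) n, ‖η t n‖ ≤ Cη * ((t : ℝ) + 1) ^ ρ)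
    (hub : ∀ t, ‖u t - θ‖ ≤ Cu)
    (hc : 0 < c) (hcβ : ∀ i ≥ s₀, c * weight b τ₂ i ≤ 1) (hC : 0 ≤ C)
    (hΦ : ∀ s ≥ s₀, ∀ t ≥ s, ∀ n l, |transition L (weight b τ₂) s t n l|
      ≤ C * ((t : ℝ) + 1) ^ δ * ∏ i ∈ Finset.Ico s t, (1 - c * weight b τ₂ i)) (n : Fin N) :
    Tendsto (fun t : ℕ => ((t : ℝ) + 1) ^ τ₀ • (x t n - u t)) atTop (𝓝 0) := by
  have hNR : (1 : ℝ) ≤ N := by exact_mod_cast hN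
  have hα : ∀ t, 0 ≤ weight a τ₁ t := fun t => by rw [weight]; positivity
  have hCu : 0 ≤ Cu := (norm_nonneg _).trans (hub 0)
  set avg : ℕ → E := fun t => (1 / (N : ℝ)) • ∑ l, x t l with havg
  set X : ℕ → ℝ := fun t => ∑ n, ‖x t n - avg t‖ with hXdef
  set w : ℕ → ℝ := fun t => ‖avg t - u t‖ with hwdef
  set CA : ℝ := ∑ n, ‖A n‖ with hCA
  have hCA0 : 0 ≤ CA := Finset.sum_nonneg fun _ _ => norm_nonneg _
  have hX0 : ∀ t, 0 ≤ X t := fun t => Finset.sum_nonneg fun _ _ => norm_nonneg _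
  have hw0 : ∀ t, 0 ≤ w t := fun t => norm_nonneg _
  have hXn : ∀ t l, ‖x t l - avg t‖ ≤ X t := fun t l =>
    Finset.single_le_sum (f := fun l => ‖x t l - avg t‖) (fun _ _ => norm_nonneg _)
      (Finset.mem_univ l)
  obtain ⟨y, hy0, hy, hXy⟩ := exists_disagreement_envelope hrow hcol hx hα hcβ hΦ
  set D : ℝ := N * C + N * Cη + CA * (1 + Cu) + 1 with hD
  have hNC : 0 ≤ N * C := by positivity
  have hNCη : 0 ≤ N * Cη := by positivity
  have hCACu : 0 ≤ CA * Cu := by positivity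
  have hD0 : 0 < D := by rw [hD]; positivity
  have hlim : Tendsto (fun t : ℕ => ((t : ℝ) + 1) ^ τ₀ * (X t + w t)) atTop (𝓝 0) := by
    refine tendsto_rpow_mul_of_coupled_recursion (y := y) (C := D) (b := c * b) hX0
      (eventually_atTop.2 ⟨s₀, hy0⟩) hw0 hτ₁ hτ₂ ha (mul_pos hc hb) hD0 hδ hρ hμ hτ₀ hrate hrate1
      ?_ ?_ ?_
    · filter_upwards [eventually_ge_atTop s₀] with t ht
      refine (hXy t ht).trans ?_
      have h1 : N * C ≤ D := by nlinarith
      have h2 := hy0 t ht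
      gcongr
    · filter_upwards [eventually_ge_atTop s₀] with t ht
      rw [hy t ht, mul_assoc c b, ← weight_eq, ← weight_eq]
      refine add_le_add le_rfl (mul_le_mul_of_nonneg_left ?_ (hα t))
      have hTρ : (1 : ℝ) ≤ ((t : ℝ) + 1) ^ ρ :=
        Real.one_le_rpow (by linarith [(Nat.cast_nonneg t : (0 : ℝ) ≤ t)]) hρ
      calc ∑ l, ‖η t l - A l (x t l - θ)‖
          ≤ ∑ l, (Cη * ((t : ℝ) + 1) ^ ρ + ‖A l‖ * (X t + w t + Cu)) := by
            refine Finset.sum_le_sum fun l _ => (norm_sub_le _ _).trans (add_le_add (hη t l) ?_)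
            refine (A l).le_opNorm_of_le ?_
            have e : x t l - θ = (x t l - avg t) + (avg t - u t) + (u t - θ) := by abel
            rw [e]
            exact norm_add₃_le.trans (add_le_add (add_le_add (hXn t l) le_rfl) (hub t))
        _ = N * Cη * ((t : ℝ) + 1) ^ ρ + CA * (X t + w t + Cu) := by
            rw [Finset.sum_add_distrib, hCA, Finset.sum_mul]
            simp only [Finset.sum_const, Finset.card_univ, Fintype.card_fin, nsmul_eq_mul]
            ring
        _ ≤ D * (((t : ℝ) + 1) ^ ρ + w t + X t) := by
            have h1 : N * Cη * ((t : ℝ) + 1) ^ ρ + CA * Cu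
                ≤ (N * Cη + CA * Cu) * ((t : ℝ) + 1) ^ ρ := by nlinarith
            have h2 : (N * Cη + CA * Cu) * ((t : ℝ) + 1) ^ ρ ≤ D * ((t : ℝ) + 1) ^ ρ := by
              gcongr; nlinarith
            have h3 : CA * (X t + w t) ≤ D * (X t + w t) := by
              have := add_nonneg (hX0 t) (hw0 t)
              gcongr; nlinarith
            linarith
    · filter_upwards [hcontr] with t ht
      rw [← weight_eq]
      -- The noise and the terms in `u t - θ` cancel, leaving the contracting step and the
      -- disagreement.
      have hstep : avg (t + 1) - u (t + 1)
          = ((avg t - u t) - (weight a τ₁ t / N) • ∑ l, A l (avg t - u t))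
            - (weight a τ₁ t / N) • ∑ l, A l (x t l - avg t) := by
        have h1 : avg (t + 1) = avg t
            + (weight a τ₁ t / N) • ∑ l, (η t l - A l (x t l - θ)) := by
          simp only [havg]
          simp_rw [hx]
          rw [sum_consensus_step hcol t (x t) fun l => weight a τ₁ t • (η t l - A l (x t l - θ)),
            smul_add, ← Finset.smul_sum, smul_smul, one_div_mul_eq_div]
        have h2 : ∀ l, A l (x t l - θ)
            = A l (x t l - avg t) + A l (avg t - u t) + A l (u t - θ) := fun l => by
          rw [← map_add, ← map_add]; congr 1; abel
        rw [h1, hu]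
        simp_rw [h2, Finset.sum_sub_distrib, Finset.sum_add_distrib, smul_sub, smul_add]
        abel
      change ‖avg (t + 1) - u (t + 1)‖ ≤ _
      rw [hstep]
      refine (norm_sub_le _ _).trans (add_le_add (ht _) ?_)
      rw [norm_smul, Real.norm_of_nonneg (div_nonneg (hα t) (by linarith))]
      refine mul_le_mul (div_le_self (hα t) hNR) ?_ (norm_nonneg _) (hα t)
      calc ‖∑ l, A l (x t l - avg t)‖ ≤ ∑ l, ‖A l‖ * X t :=
            norm_sum_le_of_le _ fun l _ => (A l).le_opNorm_of_le (hXn t l)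
        _ = CA * X t := by rw [← Finset.sum_mul]
        _ ≤ D * X t := by
            have := hX0 t
            gcongr
            nlinarith
  refine squeeze_zero_norm (fun t => ?_) hlim
  rw [norm_smul, Real.norm_of_nonneg (by positivity)]
  refine mul_le_mul_of_nonneg_left ?_ (by positivity)
  rw [← sub_add_sub_cancel _ (avg t)]
  exact (norm_add_le _ _).trans (add_le_add (hXn t n) le_rfl)

end Deterministic

/-! ### Transfer of the estimators to Euclidean space. -/

section Lift

variable {N M : ℕ} {m : Fin N → ℕ} (H : (n : Fin N) → Matrix (Fin (m n)) (Fin M) ℝ)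
  (K : Matrix (Fin M) (Fin M) ℝ)

/-- The map `ζ ↦ K Hₙᵀ ζₙ` from stacked noise vectors to innovations. -/
noncomputable def noiseGain (n : Fin N) :
    EuclideanSpace ℝ (Σ n : Fin N, Fin (m n)) →L[ℝ] EuclideanSpace ℝ (Fin M) :=
  LinearMap.toContinuousLinearMap
    { toFun := fun ζ => WithLp.toLp 2 (K *ᵥ ((H n)ᵀ *ᵥ fun k => ζ ⟨n, k⟩))
      map_add' := fun ζ ξ => by
        change WithLp.toLp 2 (K *ᵥ ((H n)ᵀ *ᵥ ((fun k => ζ ⟨n, k⟩) + fun k => ξ ⟨n, k⟩))) = _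
        rw [mulVec_add, mulVec_add, WithLp.toLp_add]
      map_smul' := fun c ζ => by
        change WithLp.toLp 2 (K *ᵥ ((H n)ᵀ *ᵥ (c • fun k => ζ ⟨n, k⟩))) = _
        rw [mulVec_smul, mulVec_smul, WithLp.toLp_smul, RingHom.id_apply] }

/-- The operator `K Hₙᵀ Hₙ` on the Euclidean space. -/
noncomputable def sensorGain (n : Fin N) :
    EuclideanSpace ℝ (Fin M) →L[ℝ] EuclideanSpace ℝ (Fin M) :=
  toEuclideanCLM (𝕜 := ℝ) (K * ((H n)ᵀ * H n))

theorem noiseGain_apply (n : Fin N) (ζ : EuclideanSpace ℝ (Σ n : Fin N, Fin (m n))) :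
    noiseGain H K n ζ = WithLp.toLp 2 (K *ᵥ ((H n)ᵀ *ᵥ fun k => ζ ⟨n, k⟩)) := rfl

theorem sensorGain_toLp (n : Fin N) (v : Fin M → ℝ) :
    sensorGain H K n (WithLp.toLp 2 v) = WithLp.toLp 2 ((K * ((H n)ᵀ * H n)) *ᵥ v) := rfl

theorem sum_sensorGain :
    ∑ n, sensorGain H K n = toEuclideanCLM (𝕜 := ℝ) (K * gram H) := by
  rw [gram, Finset.mul_sum, map_sum]
  rfl

theorem toLp_innovation (θ v : Fin M → ℝ) (γ₀ : ℝ) (i : ℕ)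
    (ζ : EuclideanSpace ℝ (Σ n : Fin N, Fin (m n))) (n : Fin N) :
    WithLp.toLp 2 (K *ᵥ ((H n)ᵀ *ᵥ observation H θ γ₀ i ζ n - ((H n)ᵀ * H n) *ᵥ v))
      = ((i : ℝ) + 1) ^ γ₀ • noiseGain H K n ζ
        - sensorGain H K n (WithLp.toLp 2 v - WithLp.toLp 2 θ) := by
  rw [← WithLp.toLp_sub, sensorGain_toLp, noiseGain_apply, ← WithLp.toLp_smul, ← WithLp.toLp_sub]
  congr 1
  simp only [observation, mulVec_add, mulVec_sub, mulVec_smul, mulVec_mulVec]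
  abel

theorem toLp_glu_succ (α β : ℕ → ℝ) (Γ : ℕ → SimpleGraph (Fin N)) (θ : Fin M → ℝ) (γ₀ : ℝ)
    (ζ : ℕ → EuclideanSpace ℝ (Σ n : Fin N, Fin (m n))) (x₀ : Fin N → Fin M → ℝ) (i : ℕ)
    (n : Fin N) :
    WithLp.toLp 2 (glu H K α β Γ (fun j => observation H θ γ₀ j (ζ j)) x₀ (i + 1) n)
      = WithLp.toLp 2 (glu H K α β Γ (fun j => observation H θ γ₀ j (ζ j)) x₀ i n)
        - β i • ∑ l, laplacian (Γ i) n l •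
          WithLp.toLp 2 (glu H K α β Γ (fun j => observation H θ γ₀ j (ζ j)) x₀ i l)
        + α i • (((i : ℝ) + 1) ^ γ₀ • noiseGain H K n (ζ i)
          - sensorGain H K n
            (WithLp.toLp 2 (glu H K α β Γ (fun j => observation H θ γ₀ j (ζ j)) x₀ i n)
              - WithLp.toLp 2 θ)) := by
  rw [← toLp_innovation]
  simp_rw [← WithLp.toLp_smul]
  rw [← WithLp.toLp_sum, ← WithLp.toLp_smul, ← WithLp.toLp_sub, ← WithLp.toLp_add,
    sum_laplacian_smul]
  simp only [glu, mulVec_sub, mulVec_mulVec]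

theorem toLp_centralized_succ (α : ℕ → ℝ) (θ : Fin M → ℝ) (γ₀ : ℝ)
    (ζ : ℕ → EuclideanSpace ℝ (Σ n : Fin N, Fin (m n))) (u₀ : Fin M → ℝ) (i : ℕ) :
    WithLp.toLp 2 (centralized H K α (fun j => observation H θ γ₀ j (ζ j)) u₀ (i + 1))
      = WithLp.toLp 2 (centralized H K α (fun j => observation H θ γ₀ j (ζ j)) u₀ i)
        + (α i / (N : ℝ)) • ∑ n, (((i : ℝ) + 1) ^ γ₀ • noiseGain H K n (ζ i)
          - sensorGain H K n
            (WithLp.toLp 2 (centralized H K α (fun j => observation H θ γ₀ j (ζ j)) u₀ i)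
              - WithLp.toLp 2 θ)) := by
  simp_rw [← toLp_innovation]
  rw [← WithLp.toLp_sum, ← WithLp.toLp_smul, ← WithLp.toLp_add]
  simp only [centralized, mulVec_sum]

theorem tendsto_toLp_iff {ι : Type*} {l : Filter ι} {f : ι → Fin M → ℝ} {v : Fin M → ℝ} :
    Tendsto (fun i => (WithLp.toLp 2 (f i) : EuclideanSpace ℝ (Fin M))) l (𝓝 (WithLp.toLp 2 v))
      ↔ Tendsto f l (𝓝 v) :=
  ⟨fun h => ((PiLp.continuous_ofLp 2 _).tendsto _).comp h,
    fun h => ((PiLp.continuous_toLp 2 _).tendsto _).comp h⟩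

theorem tendsto_weight_zero {c τ : ℝ} (hτ : 0 < τ) : Tendsto (weight c τ) atTop (𝓝 0) := by
  have h := (tendsto_rpow_neg_natCast hτ).const_mul c
  rw [mul_zero] at h
  exact h.congr fun t => (weight_eq c τ t).symm

end Lift

/-! ### The centralized estimator and the comparison. -/

section Main

variable {Ω : Type*} [MeasurableSpace Ω] {P : Measure Ω} {N M : ℕ} {m : Fin N → ℕ}
  {H : (n : Fin N) → Matrix (Fin (m n)) (Fin M) ℝ} {K : Matrix (Fin M) (Fin M) ℝ}
  {ζ : ℕ → Ω → EuclideanSpace ℝ (Σ n : Fin N, Fin (m n))} {Γ : ℕ → Ω → SimpleGraph (Fin N)}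
  {γ₀ ε τ₁ a : ℝ}

/-- The centralized step contracts at every rate below `λ_min(KG) / N`. -/
theorem exists_centralized_contraction {τ₀ : ℝ} (hN : 0 < N) (ha : 0 < a)
    (hτ₁ : 0 < τ₁) (hK : K.PosDef) (hG : (gram H).PosDef) (hc : Commute K (gram H))
    (hrate : 0 < M → τ₁ = 1 → N * τ₀ / lambdaMin (K * gram H) < a) :
    ∃ μ : ℝ, 0 < μ ∧ (τ₁ = 1 → τ₀ < a * μ) ∧
      ∀ᶠ t in atTop, ∀ v : EuclideanSpace ℝ (Fin M),
        ‖v - (weight a τ₁ t / N) • ∑ n, sensorGain H K n v‖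
          ≤ (1 - weight a τ₁ t * μ) * ‖v‖ := by
  have hNR : (0 : ℝ) < N := by exact_mod_cast hN
  rcases Nat.eq_zero_or_pos M with hM | hM
  · subst hM
    -- For `M = 0` all norms vanish, so any `μ` contracts and it only has to satisfy `τ₀ < a * μ`.
    refine ⟨|τ₀| / a + 1, by positivity, fun _ => ?_, Eventually.of_forall fun t v => ?_⟩
    · rw [mul_add, mul_div_cancel₀ _ ha.ne']
      linarith [le_abs_self τ₀]
    · have h0 : ∀ w : EuclideanSpace ℝ (Fin 0), ‖w‖ = 0 := fun w => by
        rw [Subsingleton.elim w 0, norm_zero]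
      rw [h0, h0, mul_zero]
  have hlam := lambdaMin_gain_mul_gram_pos hM hK hG hc
  set lam := lambdaMin (K * gram H) with hlamdef
  -- Strictly below `lam`, to absorb the second-order term of the step, yet above `N τ₀ / a` when
  -- `τ₁ = 1`.
  obtain ⟨ν, hν0, hν1, hν2⟩ : ∃ ν, 0 < ν ∧ ν < lam ∧ (τ₁ = 1 → N * τ₀ / a < ν) := by
    by_cases h : τ₁ = 1
    · have h1 : N * τ₀ / a < lam := by
        have := hrate hM h
        rw [div_lt_iff₀ hlam] at this
        rw [div_lt_iff₀ ha]
        linarith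
      obtain ⟨ν, h2, h3⟩ := exists_between (max_lt hlam h1)
      exact ⟨ν, (le_max_left _ _).trans_lt h2, h3, fun _ => (le_max_right _ _).trans_lt h2⟩
    · exact ⟨lam / 2, by linarith, by linarith, fun h' => (h h').elim⟩
  refine ⟨ν / N, by positivity, fun h => ?_, ?_⟩
  · have := hν2 h
    rw [div_lt_iff₀ ha] at this
    rw [← mul_div_assoc, lt_div_iff₀ hNR]
    linarith
  set T : EuclideanSpace ℝ (Fin M) →L[ℝ] EuclideanSpace ℝ (Fin M) :=
    toEuclideanCLM (𝕜 := ℝ) (K * gram H) with hT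
  have hsmall : Tendsto (fun t => weight a τ₁ t / N) atTop (𝓝 0) := by
    simpa using (tendsto_weight_zero (c := a) hτ₁).div_const (N : ℝ)
  have hev1 : ∀ᶠ t in atTop, weight a τ₁ t / N * ‖T‖ ^ 2 ≤ 2 * (lam - ν) := by
    have h := hsmall.mul_const (‖T‖ ^ 2)
    rw [zero_mul] at h
    exact h.eventually (Iic_mem_nhds (by linarith))
  have hev2 : ∀ᶠ t in atTop, weight a τ₁ t / N * ν ≤ 1 := by
    have h := hsmall.mul_const ν
    rw [zero_mul] at h
    exact h.eventually (Iic_mem_nhds one_pos)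
  filter_upwards [hev1, hev2] with t h1 h2 v
  have hs : 0 ≤ weight a τ₁ t / N := by rw [weight]; positivity
  have hsum : ∑ n, sensorGain H K n v = T v := by
    rw [hT, ← sum_sensorGain, _root_.sum_apply]
  have hco : lam * ‖v‖ ^ 2 ≤ inner ℝ v (T v) := by
    have h := lambdaMin_mul_le (isHermitian_gain_mul_gram hK hG hc) v.ofLp
    rw [hT, inner_toEuclideanCLM]
    have e : ‖v‖ ^ 2 = v.ofLp ⬝ᵥ v.ofLp := by
      rw [EuclideanSpace.norm_sq_eq]
      simp [dotProduct, sq]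
    rwa [e]
  rw [hsum]
  refine (norm_sub_smul_le hco (T.le_opNorm v) hs h1 h2).trans_eq ?_
  ring

/-- The weighted noise series converges almost surely. -/
theorem ae_exists_tendsto_sum_noise [IsProbabilityMeasure P] (hζ : NoiseAssumption P ε ζ)
    {c : ℕ → ℝ} (hc : Summable fun i => c i ^ 2) :
    ∀ᵐ ω ∂P, ∃ ℓ, Tendsto (fun t => ∑ i ∈ Finset.range t, c i • ζ i ω) atTop (𝓝 ℓ) := by
  have hL2 : ∀ i, MemLp (ζ i) 2 P := fun i =>
    (memLp_two_iff_integrable_sq_norm (hζ.measurable i).aestronglyMeasurable).2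
      (hζ.second_moment i)
  have hkm : ∀ k, Measurable fun z : EuclideanSpace ℝ (Σ n : Fin N, Fin (m n)) => z k := fun k =>
    (EuclideanSpace.proj (𝕜 := ℝ) k).continuous.measurable
  have hk2 : ∀ i k, MemLp (fun ω => ζ i ω k) 2 P := fun i k =>
    (EuclideanSpace.proj (𝕜 := ℝ) k).comp_memLp' (hL2 i)
  have hcoord : ∀ k, ∀ᵐ ω ∂P, ∃ ℓ : ℝ,
      Tendsto (fun t => ∑ i ∈ Finset.range t, c i * ζ i ω k) atTop (𝓝 ℓ) := fun k => by
    have hsq : ∀ i, ∫ ω, (c i * ζ i ω k) ^ 2 ∂P = c i ^ 2 * ∫ ω, ζ 0 ω k ^ 2 ∂P := fun i => by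
      simp_rw [mul_pow]
      rw [integral_const_mul]
      congr 1
      exact ((hζ.identDistrib i).comp ((hkm k).pow_const 2)).integral_eq
    refine ae_exists_tendsto_sum_of_iIndepFun
      (fun i => ((hkm k).comp (hζ.measurable i)).const_mul (c i))
      (hζ.indep.comp (fun i z => c i * z k) fun i => (hkm k).const_mul (c i))
      (fun i => (hk2 i k).const_mul (c i)) (fun i => ?_) ?_
    · rw [integral_const_mul]
      have h := (EuclideanSpace.proj (𝕜 := ℝ) k).integral_comp_comm
        ((hL2 i).integrable one_le_two)
      rw [hζ.mean_zero i, map_zero] at h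
      rw [show ∫ ω, ζ i ω k ∂P = 0 from h, mul_zero]
    · simp_rw [hsq]
      exact hc.mul_right _
  filter_upwards [ae_all_iff.2 hcoord] with ω hω
  choose ℓ hℓ using hω
  refine ⟨WithLp.toLp 2 ℓ, ?_⟩
  have h : Tendsto (fun t k => ∑ i ∈ Finset.range t, c i * ζ i ω k) atTop (𝓝 ℓ) :=
    tendsto_pi_nhds.2 hℓ
  refine (((PiLp.continuous_toLp 2 _).tendsto ℓ).comp h).congr fun t => ?_
  ext k
  simp

/-- Strong consistency of the centralized estimator. -/
theorem ae_tendsto_centralized [IsProbabilityMeasure P] (hN : 0 < N)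
    (hζ : NoiseAssumption P ε ζ) (hG : (gram H).PosDef)
    (hγ₀ : 0 ≤ γ₀) (hgood : GoodCentralized (gram H) γ₀ τ₁ a K) (θ : Fin M → ℝ) :
    ∀ᵐ ω ∂P, ∀ u₀ : Fin M → ℝ, Tendsto (centralized H K (weight a τ₁)
      (fun j => observation H θ γ₀ j (ζ j ω)) u₀) atTop (𝓝 θ) := by
  have hNR : (0 : ℝ) < N := by exact_mod_cast hN
  have hτ := hgood.τ_gt
  have hτ₁0 : 0 < τ₁ := by linarith
  have ha := hgood.a_pos
  obtain ⟨μ, hμ, -, hcontr⟩ := exists_centralized_contraction (τ₀ := 0) hN hgood.a_pos hτ₁0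
    hgood.K_posDef hG hgood.K_comm (fun _ _ => by simpa using hgood.a_pos)
  have hsum : Summable fun i : ℕ => (weight a τ₁ i * ((i : ℝ) + 1) ^ γ₀) ^ 2 := by
    refine ((summable_rpow_neg (p := 2 * (τ₁ - γ₀)) (by linarith)).mul_left (a ^ 2)).congr
      fun i => ?_
    have hT : (0 : ℝ) < (i : ℝ) + 1 := by positivity
    rw [weight_eq, mul_assoc, ← Real.rpow_add hT, mul_pow, ← Real.rpow_natCast (_ ^ _) 2,
      ← Real.rpow_mul hT.le]
    congr 2
    push_cast
    ring
  filter_upwards [ae_exists_tendsto_sum_noise hζ hsum] with ω ⟨ℓ, hℓ⟩ u₀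
  set R := ∑ n, noiseGain H K n with hR
  rw [← tendsto_toLp_iff, ← tendsto_sub_nhds_zero_iff]
  refine tendsto_zero_of_convergent_input (T := (1 / (N : ℝ)) • ∑ n, sensorGain H K n)
    (ξ := fun i => (1 / (N : ℝ)) • R ((weight a τ₁ i * ((i : ℝ) + 1) ^ γ₀) • ζ i ω))
    (α := weight a τ₁) (ℓ := (1 / (N : ℝ)) • R ℓ) hμ (fun t => by rw [weight]; positivity)
    (tendsto_weight_zero hτ₁0) (tendsto_sum_weight_atTop hgood.a_pos hgood.τ_le) ?_ ?_ fun t => ?_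
  · filter_upwards [hcontr] with t ht v
    simpa [smul_smul, div_eq_mul_inv] using ht v
  · simp_rw [← Finset.smul_sum, ← map_sum]
    exact ((R.continuous.tendsto ℓ).comp hℓ).const_smul _
  · rw [toLp_centralized_succ]
    simp only [hR, map_smul, _root_.sum_apply, _root_.smul_apply,
      Finset.sum_sub_distrib, smul_sub, ← Finset.smul_sum, smul_smul]
    rw [div_eq_mul_one_div, show weight a τ₁ t * (1 / (N : ℝ)) * ((t : ℝ) + 1) ^ γ₀
      = 1 / (N : ℝ) * (weight a τ₁ t * ((t : ℝ) + 1) ^ γ₀) by ring]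
    abel

/-- The distributed and the centralized estimators merge at the rate `(i + 1) ^ (-τ₀)`. -/
theorem ae_tendsto_glu_sub_centralized [IsProbabilityMeasure P] (hN : 0 < N)
    (hζ : NoiseAssumption P ε ζ) (hΓ : LinkAssumption P Γ) (hG : (gram H).PosDef)
    (hγ₀ : 0 ≤ γ₀) (hε : 0 < ε) {τ₂ b τ₀ : ℝ}
    (hdes : DesignAssumption (gram H) γ₀ ε τ₁ a τ₂ b K) (hτ₀ : 0 ≤ τ₀)
    (hrate : τ₀ < τ₁ - τ₂ - γ₀ - 1 / (2 + ε))
    (hrate1 : 0 < M → τ₁ = 1 → N * τ₀ / lambdaMin (K * gram H) < a)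
    (θ : Fin M → ℝ) (x₀ : Fin N → Fin M → ℝ) :
    ∀ᵐ ω ∂P, ∀ u₀ : Fin M → ℝ,
      Tendsto (centralized H K (weight a τ₁) (fun j => observation H θ γ₀ j (ζ j ω)) u₀) atTop
        (𝓝 θ) →
      ∀ n, Tendsto (fun i : ℕ => ((i : ℝ) + 1) ^ τ₀ •
        (glu H K (weight a τ₁) (weight b τ₂) (fun j => Γ j ω)
            (fun j => observation H θ γ₀ j (ζ j ω)) x₀ i n
          - centralized H K (weight a τ₁) (fun j => observation H θ γ₀ j (ζ j ω)) u₀ i))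
        atTop (𝓝 0) := by
  have hp : (0 : ℝ) < 2 + ε := by linarith
  have hip : (0 : ℝ) < 1 / (2 + ε) := by positivity
  have hτ₂ := hdes.τ₂_pos
  have hb := hdes.b_pos
  have hτ₁0 : 0 < τ₁ := hτ₂.trans_le hdes.τ₂_le
  -- The slack in the rate is cut into three: noise growth, loss in the transition bound, and the
  -- strict inequality left over.
  set δ := (τ₁ - τ₂ - γ₀ - 1 / (2 + ε) - τ₀) / 3 with hδdef
  have hδ : 0 < δ := by rw [hδdef]; linarith
  obtain ⟨μ, hμ, hμ1, hcontr⟩ := exists_centralized_contraction hN hdes.a_pos hτ₁0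
    hdes.K_posDef hG hdes.K_comm hrate1
  obtain ⟨c, hc, s₀, hcβ, hΦ⟩ := ae_transition_le hΓ (β := weight b τ₂)
    (fun i => by rw [weight]; positivity) (tendsto_weight_zero hτ₂) hδ
  filter_upwards [hΦ, ae_norm_le_rpow hp hδ hζ.identDistrib hζ.moment]
    with ω ⟨C, hC, hΦω⟩ ⟨Cζ, hCζ, hζω⟩ u₀ hu n
  have hu' := tendsto_toLp_iff.2 hu
  obtain ⟨Cu, hCu⟩ := ((tendsto_sub_nhds_zero_iff.2 hu').norm.bddAbove_range)
  set R : ℝ := ∑ n, ‖noiseGain H K n‖ with hR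
  have hR0 : 0 ≤ R := Finset.sum_nonneg fun _ _ => norm_nonneg _
  have key := tendsto_consensus_sub_centralized hN (L := fun i => randomLaplacian Γ i ω)
    (x := fun i n => WithLp.toLp 2 (glu H K (weight a τ₁) (weight b τ₂) (fun j => Γ j ω)
      (fun j => observation H θ γ₀ j (ζ j ω)) x₀ i n))
    (u := fun i => WithLp.toLp 2 (centralized H K (weight a τ₁)
      (fun j => observation H θ γ₀ j (ζ j ω)) u₀ i))
    (θ := WithLp.toLp 2 θ) (A := sensorGain H K)
    (η := fun i n => ((i : ℝ) + 1) ^ γ₀ • noiseGain H K n (ζ i ω))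
    (ρ := γ₀ + 1 / (2 + ε) + δ) (Cη := R * Cζ)
    (fun t n => sum_laplacian_row (Γ t ω) n) (fun t l => sum_laplacian_col (Γ t ω) l)
    (fun t n => toLp_glu_succ H K _ _ (fun j => Γ j ω) θ γ₀ (fun j => ζ j ω) x₀ t n)
    (fun t => toLp_centralized_succ H K _ θ γ₀ (fun j => ζ j ω) u₀ t)
    hdes.τ₁_le hτ₂ hdes.a_pos hb (by positivity) hδ hμ hτ₀ (by rw [hδdef]; linarith) hμ1 hcontr
    (by positivity) (fun t n => ?_) (fun t => hCu (Set.mem_range_self t)) hc hcβ hC hΦω n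
  · refine tendsto_toLp_iff.1 (key.congr fun t => ?_)
    rw [← WithLp.toLp_sub, ← WithLp.toLp_smul]
  · have hT : (0 : ℝ) < (t : ℝ) + 1 := by positivity
    have h1 : ‖noiseGain H K n‖ ≤ R :=
      Finset.single_le_sum (f := fun n => ‖noiseGain H K n‖) (fun _ _ => norm_nonneg _)
        (Finset.mem_univ n)
    rw [norm_smul, Real.norm_of_nonneg (by positivity)]
    calc ((t : ℝ) + 1) ^ γ₀ * ‖noiseGain H K n (ζ t ω)‖
        ≤ ((t : ℝ) + 1) ^ γ₀ * (R * (Cζ * ((t : ℝ) + 1) ^ (1 / (2 + ε) + δ))) := by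
          gcongr
          exact ((noiseGain H K n).le_opNorm _).trans (mul_le_mul h1 (hζω t) (norm_nonneg _) hR0)
      _ = R * Cζ * ((t : ℝ) + 1) ^ (γ₀ + 1 / (2 + ε) + δ) := by
          rw [add_assoc γ₀, Real.rpow_add hT γ₀]; ring

theorem DesignAssumption.goodCentralized {G : Matrix (Fin M) (Fin M) ℝ} {τ₂ b : ℝ}
    (h : DesignAssumption G γ₀ ε τ₁ a τ₂ b K) : GoodCentralized G γ₀ τ₁ a K :=
  ⟨h.a_pos, h.K_posDef, h.K_comm, (le_max_left _ _).trans_lt h.τ₁_gt, h.τ₁_le⟩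

/-- Since `1 / (2 + ε) < 1 / 2 < τ₁ - γ₀`, there is room for `τ₂`, taken as half of it; any `b > 0`
would do. -/
theorem GoodCentralized.exists_designAssumption {G : Matrix (Fin M) (Fin M) ℝ} (hγ₀ : 0 ≤ γ₀)
    (hε : 0 < ε) (h : GoodCentralized G γ₀ τ₁ a K) :
    ∃ τ₂ b : ℝ, DesignAssumption G γ₀ ε τ₁ a τ₂ b K := by
  have h1 : 1 / (2 + ε) < 1 / 2 := by gcongr; linarith
  have h0 : (0 : ℝ) < 1 / (2 + ε) := by positivity
  have h2 := h.τ_gt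
  exact ⟨(τ₁ - γ₀ - 1 / (2 + ε)) / 2, 1, h.a_pos, one_pos, by linarith, by linarith, h.τ_le,
    max_lt h2 (by linarith), h.K_posDef, h.K_comm⟩

end Main

end GLU

theorem theorem1 {Ω : Type*} [MeasurableSpace Ω] (P : Measure Ω) [IsProbabilityMeasure P]
    (N M : ℕ) (m : Fin N → ℕ)
    (H : (n : Fin N) → Matrix (Fin (m n)) (Fin M) ℝ)
    (θ : Fin M → ℝ) (x₀ : Fin N → Fin M → ℝ)
    (γ₀ ε : ℝ) (hγ₀ : 0 ≤ γ₀) (hγ₀' : γ₀ < 1 / 2) (hε : 0 < ε)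
    (ζ : ℕ → Ω → EuclideanSpace ℝ (Σ n : Fin N, Fin (m n)))
    (Γ : ℕ → Ω → SimpleGraph (Fin N))
    (hζ : GLU.NoiseAssumption P ε ζ)
    (hG : (GLU.gram H).rank = M)
    (hΓ : GLU.LinkAssumption P Γ)
    (hind : IndepFun (fun ω (i : ℕ) => GLU.randomLaplacian Γ i ω) (fun ω (i : ℕ) => ζ i ω) P) :
    -- consistency of every distributed estimator at every sensor
    (∀ (τ₁ a τ₂ b : ℝ) (K : Matrix (Fin M) (Fin M) ℝ),
      GLU.DesignAssumption (GLU.gram H) γ₀ ε τ₁ a τ₂ b K →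
      ∀ n : Fin N, ∀ᵐ ω ∂P,
        Tendsto (fun i => GLU.glu H K (GLU.weight a τ₁) (GLU.weight b τ₂) (fun j => Γ j ω)
          (fun j => GLU.observation H θ γ₀ j (ζ j ω)) x₀ i n) atTop (𝓝 θ)) ∧
    -- comparison with a good centralized estimator `(τ₁, a, K)`, the gain `K` and the innovation
    -- weights being the same for both estimators; the initial value `u₀` is arbitrary
    (∀ (τ₁ a : ℝ) (K : Matrix (Fin M) (Fin M) ℝ),
      GLU.GoodCentralized (GLU.gram H) γ₀ τ₁ a K →
      (∃ τ₂ b : ℝ, GLU.DesignAssumption (GLU.gram H) γ₀ ε τ₁ a τ₂ b K) ∧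
      ∀ (u₀ : Ω → Fin M → ℝ) (τ₂ b : ℝ),
        GLU.DesignAssumption (GLU.gram H) γ₀ ε τ₁ a τ₂ b K →
        ∀ τ₀ : ℝ, 0 ≤ τ₀ → τ₀ < τ₁ - τ₂ - γ₀ - 1 / (2 + ε) →
          (τ₁ = 1 → a > N * τ₀ / GLU.lambdaMin (K * GLU.gram H)) →
          ∀ n : Fin N, ∀ᵐ ω ∂P,
            Tendsto (fun i : ℕ => (((i : ℝ) + 1) ^ τ₀) •
              (GLU.glu H K (GLU.weight a τ₁) (GLU.weight b τ₂) (fun j => Γ j ω)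
                  (fun j => GLU.observation H θ γ₀ j (ζ j ω)) x₀ i n
                - GLU.centralized H K (GLU.weight a τ₁)
                  (fun j => GLU.observation H θ γ₀ j (ζ j ω)) (u₀ ω) i)) atTop (𝓝 0)) := by
  have hpd := GLU.gram_posDef hG
  refine ⟨fun τ₁ a τ₂ b K hdes n => ?_, fun τ₁ a K hgood =>
    ⟨hgood.exists_designAssumption hγ₀ hε, fun u₀ τ₂ b hdes τ₀ hτ₀ hrate hrate1 n => ?_⟩⟩
  · have hgap := (le_max_right _ _).trans_lt hdes.τ₁_gt
    -- With `τ₀ = 0` the rate condition is (A.6) itself and the condition for `τ₁ = 1` reads `0 <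
    -- a`. The auxiliary centralized estimator may start at `0`.
    filter_upwards [GLU.ae_tendsto_centralized n.pos hζ hpd hγ₀ hdes.goodCentralized θ,
      GLU.ae_tendsto_glu_sub_centralized n.pos hζ hΓ hpd hγ₀ hε hdes (τ₀ := 0) le_rfl
        (by linarith) (fun _ _ => by simpa using hdes.a_pos) θ x₀] with ω h1 h2
    have h3 := (h2 0 (h1 0) n).add (h1 0)
    simpa using h3
  · filter_upwards [GLU.ae_tendsto_centralized n.pos hζ hpd hγ₀ hgood θ,
      GLU.ae_tendsto_glu_sub_centralized n.pos hζ hΓ hpd hγ₀ hε hdes hτ₀ hrate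
        (fun _ => hrate1) θ x₀] with ω h1 h2
    -- The null set does not depend on the initial value, so `u₀` may be random.
    exact h2 (u₀ ω) (h1 (u₀ ω)) n
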